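/- A proper partial geometry $pg(s,t,\alpha)$ is a (nonempty) finite point-line geometry such that each line contains $s+1$ points, each point is on $t+1$ lines, any two distinct lines meet in at most one point, and for every point $x$ and every line $L$ not containing $x$ there are exactly $\alpha$ lines through $x$ that intersect $L$, where $0<\alpha<\min(s,t)$. An abelian Singer group of such a geometry is an abelian group $G$ of automorphisms acting sharply transitively on the points; the pair $(\mathcal S,G)$ is of rigid type if every line of $\mathcal S$ has trivial stabilizer in $G$, and $\mathcal S$ is of rigid type if such a $G$ exists. The Van Lint--Schrijver geometry is the $pg(5,5,2)$ whose points are the elements of the field $\mathbb F_{81}$ and whose lines are the $81$ translates $b+S$, $b\in\mathbb F_{81}$, of $S=\{0\}\cup\{z\in\mathbb F_{81}: z^5=1\}$. Theorem. Let $\mathcal S$ be a proper partial geometry $pg(s,t,\alpha)$ of rigid type. (1) If $\alpha\le 1000$, then either $(s,t,\alpha)=(5,5,2)$ and $\mathcal S$ is isomorphic to the Van Lint--Schrijver geometry, or $(s,t,\alpha)$ is one of $(11,23,3)$, $(39,39,15)$, $(272,272,104)$, $(2295,4591,615)$. (2) If $\mathcal S$ has fewer than $10^6$ points, then $\mathcal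 S$ is isomorphic to the Van Lint--Schrijver geometry, or it has exactly $1024$, $4096$ or $194481$ points. -/

import Mathlib

/-- The incidence relation `I` between points `P` and lines `L` is a proper partial geometry
`pg(s, t, α)`. -/
structure IsProperPartialGeometry {P L : Type*} (I : P → L → Prop) (s t α : ℕ) : Prop where
  finite_points : Finite P
  finite_lines : Finite L
  nonempty_points : Nonempty P
  /-- each line contains `s + 1` points -/
  points_on_line : ∀ ℓ : L, Set.ncard {p : P | I p ℓ} = s + 1
  /-- each point is contained in `t + 1` lines -/
  lines_through_point : ∀ p : P, Set.ncard {ℓ : L | I p ℓ} = t + 1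
  /-- two distinct lines intersect in at most one point -/
  line_inter_line : ∀ ℓ m : L, ℓ ≠ m → ∀ p q : P, I p ℓ → I p m → I q ℓ → I q m → p = q
  /-- if `x` is not on `ℓ`, exactly `α` lines through `x` intersect `ℓ` -/
  antiflag : ∀ (x : P) (ℓ : L), ¬ I x ℓ →
    Set.ncard {m : L | I x m ∧ ∃ y : P, I y m ∧ I y ℓ} = α
  alpha_pos : 0 < α
  alpha_lt : α < min s t

/-- The abelian group `G`, acting on points and lines, is a Singer group of the point-line geometry
`I`: it acts by automorphisms, and sharply transitively on the points. -/
structure IsAbelianSingerGroup (G : Type*) {P L : Type*} [CommGroup G] [MulAction G P]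
    [MulAction G L] (I : P → L → Prop) : Prop where
  smul_incident_iff : ∀ (g : G) (p : P) (ℓ : L), I (g • p) (g • ℓ) ↔ I p ℓ
  sharply_transitive : ∀ p q : P, ∃! g : G, g • p = q

/-- The pair consisting of the geometry `I` and the group `G` is a proper partial geometry
`pg(s, t, α)` of rigid type: `G` is an abelian Singer group and all lines have a trivial stabilizer
in `G`. -/
structure IsRigidPartialGeometry (G : Type*) {P L : Type*} [CommGroup G] [MulAction G P]
    [MulAction G L] (I : P → L → Prop) (s t α : ℕ) : Prop where
  partialGeometry : IsProperPartialGeometry I s t α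
  singer : IsAbelianSingerGroup G I
  rigid : ∀ ℓ : L, MulAction.stabilizer G ℓ = ⊥

/-- Isomorphism of point-line geometries. -/
def GeometryIsomorphic {P L P' L' : Type*} (I : P → L → Prop) (I' : P' → L' → Prop) : Prop :=
  ∃ (e : P ≃ P') (f : L ≃ L'), ∀ (p : P) (ℓ : L), I' (e p) (f ℓ) ↔ I p ℓ

/-- The Van Lint–Schrijver geometry. Its points are the elements of the field with 81 elements, and
its lines are the 81 translates `b + ({0} ∪ {z | z ^ 5 = 1})` of the set consisting of zero and the
five fifth roots of unity; the line `b + ({0} ∪ {z | z ^ 5 = 1})` is labelled by `b`. -/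
def VanLintSchrijver (x b : GaloisField 3 4) : Prop :=
  x - b = 0 ∨ (x - b) ^ 5 = 1

/-!
Let `G` be the Singer group of a proper `pg(s, t, α)` of rigid type, written additively and
identified with the set of points, and let `e g` be the number of lines through `0` and `g`. The
axioms say that `e 0 = t + 1`, that `e` takes the values `0` and `1` elsewhere, and that
`e * e = n e + α (t + 1)` with `n = s + t + 1 - α`
(`IsRigidPartialGeometry.isCollinearityFunction`). As `G` acts freely on the lines, `|G|` divides
their number, so that `s + 1` divides `t + 1`. Everything in the first half of the proof is about
such functions `e` on a finite abelian group.

*Parameters.* The Fourier transform of `e` at a nontrivial character is `0` or `n`, hence `n`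
divides `|G| e g - ∑ e` for all `g` (`QuadraticConvolution.dvd`), which gives `n ∣ (s + 1) (t + 1)`
and `n ∣ |G|`. Taking `p`-th powers in the group ring over the field with `p` elements shows that
each prime divisor of `|G|` divides `n` (`IsCollinearityFunction.prime_dvd`). Together with
`|G| α = (s + 1) (s t + α)` these conditions leave, for `α ≤ 1000`, the family `t + 1 = k (s + 1)`,
`α = k + 1`, `s + 1 = α (α + 1)` and eighteen further triples: the conditions are solved by an
explicit parametrization with `α + 1 = c d (g (d + j k') + j)`, and the finitely many tuples with
`α ≤ 1000` are searched by kernel evaluation (`ParameterSearch.parameters_of_dvd`). Finally, `e` is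
projected modulo a Sylow subgroup of `G`. The projection again satisfies a quadratic identity, its
values are divisible by a known number, and a variance argument bounds its value at zero
(`IsCollinearityFunction.quotient_inequality`). This excludes all but five of the parameters
(`IsCollinearityFunction.parameters`). The triple `(1869, 1869, 714)` needs in addition that the set
`{g ≠ 0 | e g = 1}` is closed under doubling, by the Frobenius identity for `p = 2`.

*The geometry with parameters `(5, 5, 2)`.* Here `|G| = 81`, and `G` is sharply transitive on the
lines, so the geometry is determined by one line `Λ ∋ 0`, a set of six group elements
(`IsSingerLine`). In the group ring over the field with three elements `Λ Λ Λ⁻¹` is a constant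
multiple of the sum of all group elements, so that `Λ³ Λ⁻¹ = 0`, and `Λ³` is the image of `Λ` under
multiplication by `3`. It follows that the map `l ↦ 3 l` has fibers of order divisible by three on
`Λ`, and from this that `G` has exponent three (`IsSingerLine.three_nsmul_eq_zero`). The six points
of `Λ` are then affinely dependent in a four-dimensional space, and the only dependency compatible
with the axioms is `∑ l ∈ Λ, l = 0` (`IsSingerLine.sum_eq_zero`). Hence the five nonzero elements of
`Λ` consist of a basis and minus the sum of that basis, as do the fifth roots of unity in the field
with `81` elements, and a linear isomorphism identifies them.

*Few points.* The classification for `α ≤ 1000` covers the geometries with fewer than `10 ^ 6`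
points, because `s ^ 2 < |G|` (`IsCollinearityFunction.le_of_card_lt`).
-/

/-! ### Functions with a quadratic convolution identity -/

/-- The function `e` on the finite abelian group `A` satisfies `e * e = n • e + l • 1` with respect
to convolution. -/
def QuadraticConvolution {A : Type*} [AddCommGroup A] [Fintype A] (e : A → ℤ) (n l : ℤ) : Prop :=
  ∀ g, ∑ a, e a * e (g - a) = n * e g + l

theorem AddSubgroup.card_fiber_mk {A : Type*} [AddCommGroup A] [Fintype A] (H : AddSubgroup A)
    [DecidableEq (A ⧸ H)] (x : A ⧸ H) :
    Finset.card {a | (QuotientAddGroup.mk a : A ⧸ H) = x} = Nat.card H := by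
  classical
  obtain ⟨x, rfl⟩ := QuotientAddGroup.mk_surjective x
  rw [Nat.card_eq_fintype_card, ← Finset.card_univ]
  symm
  refine Finset.card_bij (fun h _ => x + h) ?_ ?_ ?_
  · intro h _
    simp [QuotientAddGroup.eq]
  · intro h _ h' _ hh
    exact Subtype.ext (add_left_cancel hh)
  · intro b hb
    refine ⟨⟨-x + b, ?_⟩, Finset.mem_univ _, by simp⟩
    exact QuotientAddGroup.eq.1 (Finset.mem_filter.1 hb).2.symm

namespace QuadraticConvolution

variable {A : Type*} [AddCommGroup A] [Fintype A] {e : A → ℤ} {n l : ℤ}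

theorem sum_sq (h : QuadraticConvolution e n l) :
    (∑ a, e a) * (∑ a, e a) = n * ∑ a, e a + Fintype.card A * l := by
  have h1 : ∑ g, ∑ a, e a * e (g - a) = (∑ a, e a) * (∑ a, e a) := by
    rw [Finset.sum_comm, Finset.sum_mul]
    refine Finset.sum_congr rfl fun a _ => ?_
    rw [← Finset.mul_sum]
    congr 1
    exact (Equiv.subRight a).sum_comp e
  rw [← h1, Finset.sum_congr rfl fun g _ => h g, Finset.sum_add_distrib, ← Finset.mul_sum]
  simp

/-- At a nontrivial character the transform of `e` is `0` or `n`. -/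
theorem transform_eq_zero_or (h : QuadraticConvolution e n l) {ψ : AddChar A ℂ} (hψ : ψ ≠ 0) :
    ∑ a, (e a : ℂ) * ψ a = 0 ∨ ∑ a, (e a : ℂ) * ψ a = n := by
  have h1 : (∑ a, (e a : ℂ) * ψ a) * (∑ a, (e a : ℂ) * ψ a) = n * ∑ a, (e a : ℂ) * ψ a := by
    have h2 : ∑ g, (∑ a, (e a : ℂ) * e (g - a)) * ψ g
        = (∑ a, (e a : ℂ) * ψ a) * (∑ a, (e a : ℂ) * ψ a) := by
      simp_rw [Finset.sum_mul]
      rw [Finset.sum_comm]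
      refine Finset.sum_congr rfl fun a _ => ?_
      rw [Finset.mul_sum, ← (Equiv.subRight a).sum_comp (fun g => (e a : ℂ) * ψ a * (e g * ψ g))]
      refine Finset.sum_congr rfl fun g _ => ?_
      have : ψ g = ψ a * ψ (g - a) := by rw [← AddChar.map_add_eq_mul]; simp
      simp only [Equiv.subRight_apply, this]
      ring
    have h3 : ∀ g, (∑ a, (e a : ℂ) * e (g - a)) = n * e g + l := fun g => by exact_mod_cast h g
    rw [← h2]
    simp_rw [h3, add_mul, Finset.sum_add_distrib, mul_assoc, ← Finset.mul_sum,
      AddChar.sum_eq_zero_of_ne_one hψ]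
    simp
  have h4 : (∑ a, (e a : ℂ) * ψ a) * ((∑ a, (e a : ℂ) * ψ a) - n) = 0 := by
    rw [mul_sub, h1]; ring
  rcases mul_eq_zero.1 h4 with h5 | h5
  · exact Or.inl h5
  · exact Or.inr (sub_eq_zero.1 h5)

/-- By Fourier inversion `(|A| e x - ∑ e) / n` is a sum of roots of unity, hence an algebraic
integer, hence an integer. -/
theorem dvd (h : QuadraticConvolution e n l) (hn : n ≠ 0) (x : A) :
    n ∣ Fintype.card A * e x - ∑ a, e a := by
  classical
  have hinv : ∑ ψ : AddChar A ℂ, (∑ a, (e a : ℂ) * ψ a) * ψ (-x) = Fintype.card A * e x := by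
    simp_rw [Finset.sum_mul]
    rw [Finset.sum_comm]
    have : ∀ a, ∑ ψ : AddChar A ℂ, (e a : ℂ) * ψ a * ψ (-x)
        = if a = x then (e a : ℂ) * Fintype.card A else 0 := fun a => by
      have h1 : ∀ ψ : AddChar A ℂ, (e a : ℂ) * ψ a * ψ (-x) = e a * ψ (a - x) := fun ψ => by
        rw [sub_eq_add_neg, AddChar.map_add_eq_mul, mul_assoc]
      simp_rw [h1]
      rw [← Finset.mul_sum, AddChar.sum_apply_eq_ite]
      simp [sub_eq_zero]
    simp_rw [this]
    simp [mul_comm]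
  obtain ⟨z, hz, hzi⟩ : ∃ z : ℂ, (Fintype.card A * e x : ℂ) = (∑ a, e a : ℤ) + n * z ∧
      IsIntegral ℤ z := by
    refine ⟨∑ ψ ∈ Finset.univ.erase (0 : AddChar A ℂ),
      if ∑ a, (e a : ℂ) * ψ a = 0 then 0 else ψ (-x), ?_, ?_⟩
    · rw [← hinv, ← Finset.add_sum_erase _ _ (Finset.mem_univ (0 : AddChar A ℂ)), Finset.mul_sum]
      congr 1
      · simp
      · refine Finset.sum_congr rfl fun ψ hψ => ?_
        split_ifs with h0
        · simp [h0]
        · rw [(h.transform_eq_zero_or (Finset.ne_of_mem_erase hψ)).resolve_left h0]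
    · refine IsIntegral.sum _ fun ψ _ => ?_
      split_ifs
      · exact isIntegral_zero
      · refine IsIntegral.of_pow (n := Fintype.card A) Fintype.card_pos ?_
        rw [← AddChar.map_nsmul_eq_pow, card_nsmul_eq_zero, AddChar.map_zero_eq_one]
        exact isIntegral_one
  have hnC : (n : ℂ) ≠ 0 := by exact_mod_cast hn
  have hz2 : z = algebraMap ℚ ℂ ((Fintype.card A * e x - ∑ a, e a : ℤ) / n) := by
    rw [eq_ratCast]
    push_cast
    rw [eq_div_iff hnC]
    push_cast at hz
    rw [hz]; ring
  rw [hz2, isIntegral_algebraMap_iff (algebraMap ℚ ℂ).injective] at hzi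
  obtain ⟨m, hm⟩ := IsIntegrallyClosed.isIntegral_iff.1 hzi
  refine ⟨m, ?_⟩
  have hnQ : (n : ℚ) ≠ 0 := by exact_mod_cast hn
  rw [eq_div_iff hnQ] at hm
  have : ((m * n : ℤ) : ℚ) = ((Fintype.card A * e x - ∑ a, e a : ℤ) : ℚ) := by
    rw [← hm]; simp
  rw [mul_comm n m]
  exact (Int.cast_injective this).symm

/-- Summing over the cosets of a subgroup preserves the quadratic identity. -/
theorem quotient (h : QuadraticConvolution e n l) (H : AddSubgroup A) [Fintype (A ⧸ H)]
    [DecidableEq (A ⧸ H)] :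
    QuadraticConvolution (fun x : A ⧸ H => ∑ a with (QuotientAddGroup.mk a : A ⧸ H) = x, e a) n
      (Nat.card H * l) := by
  intro x
  have key : ∑ y : A ⧸ H, (∑ a with (QuotientAddGroup.mk a : A ⧸ H) = y, e a) *
      (∑ b with (QuotientAddGroup.mk b : A ⧸ H) = x - y, e b)
      = ∑ g with (QuotientAddGroup.mk g : A ⧸ H) = x, ∑ a, e a * e (g - a) := by
    rw [Finset.sum_comm]
    have h1 : ∀ y : A ⧸ H, (∑ a with (QuotientAddGroup.mk a : A ⧸ H) = y, e a) *
      (∑ b with (QuotientAddGroup.mk b : A ⧸ H) = x - y, e b)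
      = ∑ a with (QuotientAddGroup.mk a : A ⧸ H) = y, e a *
        (∑ b with (QuotientAddGroup.mk b : A ⧸ H) = x - QuotientAddGroup.mk a, e b) := fun y => by
      rw [Finset.sum_mul]
      refine Finset.sum_congr rfl fun a ha => ?_
      rw [(Finset.mem_filter.1 ha).2]
    simp_rw [h1]
    rw [Finset.sum_fiberwise]
    refine Finset.sum_congr rfl fun a _ => ?_
    rw [← Finset.mul_sum]
    congr 1
    refine Finset.sum_bij' (fun b _ => b + a) (fun g _ => g - a) ?_ ?_ ?_ ?_ ?_
    · intro b hb
      simp only [Finset.mem_filter, Finset.mem_univ, true_and] at hb ⊢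
      rw [QuotientAddGroup.mk_add, hb]; abel
    · intro g hg
      simp only [Finset.mem_filter, Finset.mem_univ, true_and] at hg ⊢
      rw [QuotientAddGroup.mk_sub, hg]
    · intros; simp
    · intros; simp
    · intros; simp
  show ∑ y : A ⧸ H, _ = _
  rw [key, Finset.sum_congr rfl fun g _ => h g, Finset.sum_add_distrib, ← Finset.mul_sum]
  congr 1
  rw [Finset.sum_const, nsmul_eq_mul]
  congr 2
  rw [AddSubgroup.card_fiber_mk]

end QuadraticConvolution

/-! ### The Frobenius endomorphism of the group ring -/

section GroupRing

open AddMonoidAlgebra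

variable {R A : Type*} [CommSemiring R] [Fintype A]

/-- The element `∑ a, f a • [a]` of the group ring `R[A]`. -/
noncomputable def groupRingOf (f : A → R) : AddMonoidAlgebra R A := ∑ a, single a (f a)

theorem coeff_groupRingOf (f : A → R) (y : A) : (groupRingOf f).coeff y = f y := by
  classical
  simp [groupRingOf, Finsupp.finsetSum_apply, Finsupp.single_apply]

theorem groupRingOf_mul [AddCommGroup A] (f g : A → R) :
    groupRingOf f * groupRingOf g = groupRingOf fun y => ∑ a, f a * g (y - a) := by
  classical
  have h1 : ∀ y, single y (∑ a, f a * g (y - a)) = ∑ a, single y (f a * g (y - a)) := fun y =>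
    map_sum (singleAddHom y) _ _
  simp only [groupRingOf, Finset.sum_mul_sum, single_mul_single, h1]
  rw [Finset.sum_comm (s := Finset.univ (α := A)) (t := Finset.univ)
    (f := fun y a => single y (f a * g (y - a)))]
  refine Finset.sum_congr rfl fun a _ => ?_
  rw [← (Equiv.subRight a).sum_comp (fun b => single (a + b) (f a * g b))]
  refine Finset.sum_congr rfl fun b _ => ?_
  simp

/-- The Frobenius endomorphism of the group ring over the field with `p` elements. -/
theorem groupRingOf_pow_char (p : ℕ) [hp : Fact p.Prime] [AddCommGroup A] [DecidableEq A]
    (f : A → ZMod p) :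
    groupRingOf f ^ p = groupRingOf fun y => ∑ x with p • x = y, f x := by
  have : CharP (AddMonoidAlgebra (ZMod p) A) p :=
    charP_of_injective_algebraMap (algebraMap (ZMod p) _).injective p
  have h1 : ∀ y, single y (∑ x with p • x = y, f x) = ∑ x with p • x = y, single y (f x) :=
    fun y => map_sum (singleAddHom y) _ _
  simp only [groupRingOf, sum_pow_char p, single_pow, h1]
  rw [← Finset.sum_fiberwise Finset.univ (fun x : A => p • x)]
  refine Finset.sum_congr rfl fun y _ => Finset.sum_congr rfl fun x hx => ?_
  rw [(Finset.mem_filter.1 hx).2, ZMod.pow_card]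

end GroupRing

namespace QuadraticConvolution

variable {A : Type*} [AddCommGroup A] [Fintype A] {e : A → ℤ} {n l : ℤ}

/-- In the group ring over the field with `p` elements the `p`-th power of `e` is on the one hand
its image under multiplication by `p`, and on the other hand `n ^ (p - 1) • e` up to a constant. -/
theorem frobenius (h : QuadraticConvolution e n l) (p : ℕ) [hp : Fact p.Prime] [DecidableEq A] :
    ∃ c : ZMod p, ∀ y, ((∑ x with p • x = y, e x : ℤ) : ZMod p) = n ^ (p - 1) * e y + c := by
  set f : A → ZMod p := fun a => (e a : ZMod p) with hf
  have key : ∀ j : ℕ, ∃ c : ZMod p, groupRingOf f ^ (j + 1)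
      = groupRingOf fun y => (n : ZMod p) ^ j * f y + c := by
    intro j
    induction j with
    | zero => exact ⟨0, by simp⟩
    | succ j ih =>
      obtain ⟨c, hc⟩ := ih
      refine ⟨n ^ j * l + c * ∑ a, f a, ?_⟩
      rw [pow_succ, hc, groupRingOf_mul]
      congr 1
      ext y
      have h1 : ∑ a, f a * f (y - a) = n * f y + l := by
        have := congrArg (Int.cast : ℤ → ZMod p) (h y)
        push_cast at this
        exact this
      have h2 : ∑ a, f (y - a) = ∑ a, f a := (Equiv.subLeft y).sum_comp f
      simp_rw [add_mul, Finset.sum_add_distrib, mul_assoc, ← Finset.mul_sum, h1, h2]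
      ring
  obtain ⟨c, hc⟩ := key (p - 1)
  refine ⟨c, fun y => ?_⟩
  rw [Nat.sub_add_cancel hp.out.one_le, groupRingOf_pow_char] at hc
  have := congrArg (fun z => z.coeff y) hc
  simp only [coeff_groupRingOf] at this
  rw [← this]
  simp [hf]

/-- If `|A|` and `n` are odd, `e` is invariant modulo two under doubling. -/
theorem two_nsmul_modEq (h : QuadraticConvolution e n l) (hA : Odd (Fintype.card A)) (hn : Odd n)
    (x : A) : e (2 • x) ≡ e x [ZMOD 2] := by
  classical
  have : Fact (Nat.Prime 2) := ⟨Nat.prime_two⟩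
  obtain ⟨c, hc⟩ := h.frobenius 2
  have hinj : ∀ x y : A, 2 • x = 2 • y → x = y := by
    intro x y hxy
    have hcop : (Nat.card A).Coprime 2 := by
      rw [Nat.card_eq_fintype_card]; exact Nat.Coprime.symm (Nat.coprime_two_left.2 hA)
    exact (nsmulCoprime hcop).injective hxy
  have hn1 : (n : ZMod 2) = 1 := by
    obtain ⟨m, rfl⟩ := hn
    push_cast
    rw [show (2 : ZMod 2) = 0 from rfl]; simp
  have h1 : ∀ x, (e x : ZMod 2) = e (2 • x) + c := by
    intro x
    have := hc (2 • x)
    have h3 : (Finset.univ.filter fun z : A => 2 • z = 2 • x) = {x} := by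
      ext z; simp only [Finset.mem_filter, Finset.mem_univ, true_and, Finset.mem_singleton]
      exact ⟨fun hz => hinj _ _ hz, fun hz => by rw [hz]⟩
    rw [h3, Finset.sum_singleton, hn1] at this
    simpa using this
  have hc0 : c = 0 := by
    have := h1 0
    rw [smul_zero] at this
    simpa using this
  refine (ZMod.intCast_eq_intCast_iff _ _ 2).1 ?_
  have := h1 x
  rw [hc0, add_zero] at this
  exact this.symm

end QuadraticConvolution

/-! ### Collinearity functions -/

/-- The properties of the function `e` counting the lines through `0` and a second point, for a
proper partial geometry `pg(s, t, α)` with point set a finite abelian group `A` of automorphisms. -/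
structure IsCollinearityFunction {A : Type*} [AddCommGroup A] [Fintype A] (e : A → ℤ)
    (s t α : ℕ) : Prop where
  conv : QuadraticConvolution e (s + t + 1 - α) (α * (t + 1))
  map_zero : e 0 = t + 1
  zero_or_one : ∀ g, g ≠ 0 → e g = 0 ∨ e g = 1
  map_neg : ∀ g, e (-g) = e g
  sum_eq : ∑ a, e a = (s + 1) * (t + 1)
  pos : 0 < α
  lt_left : α < s
  lt_right : α < t

namespace IsCollinearityFunction

variable {A : Type*} [AddCommGroup A] [Fintype A] {e : A → ℤ} {s t α : ℕ}

theorem card_mul (h : IsCollinearityFunction e s t α) :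
    (Fintype.card A : ℤ) * α = (s + 1) * (s * t + α) := by
  have h1 := h.conv.sum_sq
  rw [h.sum_eq] at h1
  have h2 : (t + 1 : ℤ) ≠ 0 := by positivity
  apply mul_right_cancel₀ h2
  linear_combination -h1

theorem n_pos (h : IsCollinearityFunction e s t α) : (0 : ℤ) < s + t + 1 - α := by
  have := h.lt_left
  omega

theorem sum_erase [DecidableEq A] (h : IsCollinearityFunction e s t α) :
    ∑ a ∈ Finset.univ.erase 0, e a = s * (t + 1) := by
  have := Finset.add_sum_erase Finset.univ e (Finset.mem_univ 0)
  rw [h.sum_eq, h.map_zero] at this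
  linear_combination this

theorem exists_eq_one (h : IsCollinearityFunction e s t α) : ∃ g ≠ 0, e g = 1 := by
  classical
  by_contra! hne
  have h1 := h.sum_erase
  rw [Finset.sum_eq_zero fun g hg => (h.zero_or_one g (Finset.ne_of_mem_erase hg)).resolve_right
    (hne g (Finset.ne_of_mem_erase hg))] at h1
  have := h.lt_left
  have : (0 : ℤ) < s * (t + 1) := by
    have : 0 < s := by omega
    positivity
  omega

theorem exists_eq_zero (h : IsCollinearityFunction e s t α) : ∃ g ≠ 0, e g = 0 := by
  classical
  by_contra! hne
  have h1 := h.sum_erase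
  rw [Finset.sum_congr rfl fun g hg => (h.zero_or_one g (Finset.ne_of_mem_erase hg)).resolve_left
    (hne g (Finset.ne_of_mem_erase hg))] at h1
  have h2 := h.card_mul
  have h3 : ((Finset.univ.erase (0 : A)).card : ℤ) = Fintype.card A - 1 := by
    rw [Finset.card_erase_of_mem (Finset.mem_univ _), Finset.card_univ,
      Nat.cast_sub Fintype.card_pos]
    simp
  rw [Finset.sum_const, nsmul_eq_mul, mul_one, h3] at h1
  have h4 : (s * t : ℤ) * (α - (s + 1)) = 0 := by
    linear_combination h2 - (α : ℤ) * h1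
  have h5 := h.lt_left
  have h6 := h.lt_right
  rcases mul_eq_zero.1 h4 with h7 | h7
  · have : (0 : ℤ) < s * t := by
      have : 0 < s := by omega
      have : 0 < t := by omega
      positivity
    omega
  · omega

theorem dvd_sum (h : IsCollinearityFunction e s t α) :
    (s + t + 1 - α : ℤ) ∣ (s + 1) * (t + 1) := by
  obtain ⟨g, -, hg⟩ := h.exists_eq_zero
  have := h.conv.dvd h.n_pos.ne' g
  rw [hg, h.sum_eq] at this
  simpa using this

theorem dvd_card (h : IsCollinearityFunction e s t α) :
    (s + t + 1 - α : ℤ) ∣ Fintype.card A := by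
  obtain ⟨g, -, hg⟩ := h.exists_eq_one
  have := h.conv.dvd h.n_pos.ne' g
  rw [hg, h.sum_eq, mul_one] at this
  exact (dvd_sub_left h.dvd_sum).1 this

/-- If a prime `p` divided `|A|` but not `n`, the Frobenius identity would make `e` constant outside
the proper subgroup `pA`. The constant `0` contradicts connectedness of the collinearity graph, the
constant `1` connectedness of its complement. -/
theorem prime_dvd (h : IsCollinearityFunction e s t α) {p : ℕ} (hp : p.Prime)
    (hpA : p ∣ Fintype.card A) : (p : ℤ) ∣ s + t + 1 - α := by
  classical
  by_contra hpn
  have : Fact p.Prime := ⟨hp⟩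
  obtain ⟨c, hc⟩ := h.conv.frobenius p
  have hn1 : (((s + t + 1 - α : ℤ) : ZMod p)) ^ (p - 1) = 1 := by
    apply ZMod.pow_card_sub_one_eq_one
    rwa [Ne, ZMod.intCast_zmod_eq_zero_iff_dvd]
  simp only [hn1, one_mul] at hc
  set K : AddSubgroup A := (nsmulAddMonoidHom (α := A) p).range with hK
  have hmemK : ∀ y, y ∈ K ↔ ∃ x, p • x = y := fun y => by simp [hK, AddMonoidHom.mem_range]
  -- multiplication by `p` is not injective, hence not surjective
  obtain ⟨y₀, hy₀⟩ : ∃ y, y ∉ K := by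
    by_contra! hall
    have hsurj : Function.Surjective fun x : A => p • x := fun y => (hmemK y).1 (hall y)
    have hinj := Finite.injective_iff_surjective.2 hsurj
    obtain ⟨x, hx⟩ := exists_prime_addOrderOf_dvd_card p hpA
    have h1 : x = 0 := hinj (by
      show p • x = p • 0
      rw [smul_zero, ← hx, addOrderOf_nsmul_eq_zero])
    rw [h1, addOrderOf_zero] at hx
    exact hp.one_lt.ne hx
  have hout : ∀ y, y ∉ K → (e y : ZMod p) = -c := by
    intro y hy
    have := hc y
    rw [Finset.filter_eq_empty_iff.2 fun x _ hx => hy ((hmemK y).2 ⟨x, hx⟩)] at this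
    simp only [Finset.sum_empty, Int.cast_zero] at this
    linear_combination -this
  have hne : ∀ y, y ∉ K → y ≠ 0 := fun y hy h0 => hy (h0 ▸ K.zero_mem)
  have hconst : ∀ y, y ∉ K → e y = e y₀ := by
    intro y hy
    have h1 := (hout y hy).trans (hout y₀ hy₀).symm
    rcases h.zero_or_one y (hne y hy) with h2 | h2 <;>
      rcases h.zero_or_one y₀ (hne y₀ hy₀) with h3 | h3 <;> simp [h2, h3] at h1 ⊢
  have hconv := h.conv y₀
  have hmem : ∀ a, a ∈ K → y₀ - a ∉ K := fun a ha h1 => hy₀ (by simpa using K.add_mem h1 ha)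
  rcases h.zero_or_one y₀ (hne y₀ hy₀) with h0 | h1
  · rw [Finset.sum_eq_zero, h0] at hconv
    · have := h.pos
      have : (0 : ℤ) < α * (t + 1) := by positivity
      linarith
    · intro a _
      by_cases ha : a ∈ K
      · rw [hconst _ (hmem a ha), h0, mul_zero]
      · rw [hconst _ ha, h0, zero_mul]
  · have h2 : ∑ a, (1 - e a) * (1 - e (y₀ - a)) = 0 := by
      refine Finset.sum_eq_zero fun a _ => ?_
      by_cases ha : a ∈ K
      · rw [hconst _ (hmem a ha), h1]; simp
      · rw [hconst _ ha, h1]; simp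
    have h3 : ∑ a, (1 - e a) * (1 - e (y₀ - a))
        = Fintype.card A - ∑ a, e a - ∑ a, e (y₀ - a) + ∑ a, e a * e (y₀ - a) := by
      simp only [sub_mul, mul_sub, Finset.sum_sub_distrib, one_mul, mul_one, Finset.sum_const]
      simp
      ring
    have h4 : ∑ a, e (y₀ - a) = ∑ a, e a := (Equiv.subLeft y₀).sum_comp e
    rw [h3, h4, hconv, h.sum_eq, h1] at h2
    have h5 := h.card_mul
    have h6 : ((s : ℤ) - α) * (s - α + 1) * (t + 1 - 1) = 0 := by
      linear_combination (α : ℤ) * h2 - h5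
    have h7 := h.lt_left
    have h8 := h.lt_right
    have : 0 < ((s : ℤ) - α) * (s - α + 1) * (t + 1 - 1) := by
      apply mul_pos (mul_pos _ _) <;> omega
    omega

/-- Projecting `e` modulo a subgroup `H` gives a nonnegative function on `A ⧸ H` with known first
and second moments, all of whose values are divisible by every divisor `a` of `n` coprime to
`|A ⧸ H|`. Summing `(c - a Q) (c - a (Q + 1)) ≥ 0` over the nonzero values `c` bounds the value at
`0`, which is `t + 1 + d` for the number `d` of nonzero elements of `H` collinear with `0`. -/
theorem quotient_inequality [DecidableEq A] (h : IsCollinearityFunction e s t α)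
    (H : AddSubgroup A) [DecidablePred (· ∈ H)] {a : ℕ} (ha : (a : ℤ) ∣ s + t + 1 - α)
    (haH : a.Coprime H.index) :
    let d := Finset.card {g | g ∈ H ∧ g ≠ 0 ∧ e g = 1}
    d < Nat.card H ∧ a ∣ t + 1 + d ∧ ∀ Q : ℤ,
      0 ≤ (s + t + 1 - α : ℤ) * (t + 1 + d) + Nat.card H * (α * (t + 1)) - (t + 1 + d) ^ 2
        - a * (2 * Q + 1) * ((s + 1) * (t + 1) - (t + 1 + d))
        + (H.index - 1) * a ^ 2 * Q * (Q + 1) := by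
  classical
  intro d
  have : Fintype (A ⧸ H) := Fintype.ofFinite _
  have hq := h.conv.quotient H
  set c : A ⧸ H → ℤ := fun x => ∑ a with (QuotientAddGroup.mk a : A ⧸ H) = x, e a with hc
  have hcard : Fintype.card (A ⧸ H) = H.index := by
    rw [AddSubgroup.index, Nat.card_eq_fintype_card]
  have hsum : ∑ x, c x = (s + 1) * (t + 1) := by
    rw [hc, ← h.sum_eq]
    exact Finset.sum_fiberwise _ _ _
  have hneg : ∀ x, c (-x) = c x := by
    intro x
    refine Finset.sum_bij' (fun b _ => -b) (fun b _ => -b) ?_ ?_ ?_ ?_ ?_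
    · intro b hb
      simp only [Finset.mem_filter, Finset.mem_univ, true_and] at hb ⊢
      rw [QuotientAddGroup.mk_neg, hb, neg_neg]
    · intro b hb
      simp only [Finset.mem_filter, Finset.mem_univ, true_and] at hb ⊢
      rw [QuotientAddGroup.mk_neg, hb]
    · simp
    · simp
    · intro b _
      exact (h.map_neg b).symm
  have hdvd : ∀ x, (a : ℤ) ∣ c x := by
    intro x
    have h1 := ha.trans (hq.dvd h.n_pos.ne' x)
    rw [hsum] at h1
    have h2 := (dvd_sub_left (ha.trans h.dvd_sum)).1 h1
    rw [hcard] at h2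
    exact (Int.isCoprime_iff_gcd_eq_one.2 (by simpa using haH)).dvd_of_dvd_mul_left h2
  have hc0 : c 0 = t + 1 + d := by
    have h1 : (Finset.univ.filter fun b : A => (QuotientAddGroup.mk b : A ⧸ H) = 0)
        = Finset.univ.filter (· ∈ H) := by
      ext b; simp
    rw [hc]
    simp only [h1]
    rw [← Finset.add_sum_erase _ e (a := 0) (by simp [H.zero_mem]), h.map_zero]
    congr 1
    have h2 : ∀ b ∈ (Finset.univ.filter (· ∈ H)).erase 0, e b = if e b = 1 then 1 else 0 := by
      intro b hb
      rcases h.zero_or_one b (Finset.ne_of_mem_erase hb) with h3 | h3 <;> simp [h3]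
    rw [Finset.sum_congr rfl h2, Finset.sum_boole]
    congr 2
    ext b
    simp only [Finset.mem_filter, Finset.mem_erase, Finset.mem_univ, true_and]
    tauto
  refine ⟨?_, ?_, ?_⟩
  · have h1 : (Finset.univ.filter (· ∈ H)).card = Nat.card H := by
      rw [Nat.card_eq_fintype_card, Fintype.card_subtype]
    rw [← h1]
    apply Finset.card_lt_card
    refine ⟨fun b hb => ?_, fun hsub => ?_⟩
    · simp only [Finset.mem_filter, Finset.mem_univ, true_and] at hb ⊢
      exact hb.1
    · have := hsub (show (0 : A) ∈ _ by simp [H.zero_mem])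
      simp at this
  · have := hdvd 0
    rw [hc0] at this
    exact_mod_cast this
  · intro Q
    have h1 : ∑ x, c x * c x = (s + t + 1 - α) * c 0 + Nat.card H * (α * (t + 1)) := by
      have := hq 0
      rw [← this]
      refine Finset.sum_congr rfl fun x _ => ?_
      rw [zero_sub, hneg]
    have h2 : 0 ≤ ∑ x ∈ Finset.univ.erase 0, (c x - a * Q) * (c x - a * (Q + 1)) := by
      refine Finset.sum_nonneg fun x _ => ?_
      obtain ⟨m, hm⟩ := hdvd x
      rw [hm]
      have : 0 ≤ (m - Q) * (m - (Q + 1)) := by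
        rcases le_or_gt m Q with h3 | h3
        · exact mul_nonneg_of_nonpos_of_nonpos (by omega) (by omega)
        · exact mul_nonneg (by omega) (by omega)
      calc (0 : ℤ) ≤ a ^ 2 * ((m - Q) * (m - (Q + 1))) := by positivity
        _ = _ := by ring
    have h3 : ∑ x ∈ Finset.univ.erase 0, (c x - a * Q) * (c x - a * (Q + 1))
        = ∑ x ∈ Finset.univ.erase 0, c x * c x
          - a * (2 * Q + 1) * ∑ x ∈ Finset.univ.erase 0, c x
          + (H.index - 1) * (a ^ 2 * Q * (Q + 1)) := by
      have h4 : ((Finset.univ.erase (0 : A ⧸ H)).card : ℤ) = H.index - 1 := by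
        rw [Finset.card_erase_of_mem (Finset.mem_univ _), Finset.card_univ,
          Nat.cast_sub Fintype.card_pos, hcard]
        simp
      have h5 : (H.index - 1) * (a ^ 2 * Q * (Q + 1))
          = ∑ x ∈ Finset.univ.erase (0 : A ⧸ H), (a ^ 2 * Q * (Q + 1) : ℤ) := by
        rw [Finset.sum_const, nsmul_eq_mul, h4]
      rw [h5, Finset.mul_sum, ← Finset.sum_sub_distrib, ← Finset.sum_add_distrib]
      exact Finset.sum_congr rfl fun x _ => by ring
    have h5 := Finset.add_sum_erase Finset.univ c (Finset.mem_univ 0)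
    have h6 := Finset.add_sum_erase Finset.univ (fun x => c x * c x) (Finset.mem_univ 0)
    rw [hsum, hc0] at h5
    rw [h1, hc0] at h6
    rw [h3] at h2
    have h7 : ∑ x ∈ Finset.univ.erase 0, c x = (s + 1) * (t + 1) - (t + 1 + d) := by linarith
    have h8 : ∑ x ∈ Finset.univ.erase 0, c x * c x = (s + t + 1 - α) * (t + 1 + d)
      + Nat.card H * (α * (t + 1)) - (t + 1 + d) * (t + 1 + d) := by linarith
    rw [h7, h8] at h2
    calc _ ≤ _ := h2
      _ = _ := by ring

end IsCollinearityFunction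

/-! ### Counting lines of a partial geometry -/

namespace IsProperPartialGeometry

variable {P L : Type*} {I : P → L → Prop} {s t α : ℕ}

/-- The number of lines through two points, as an integer. -/
noncomputable def linesThrough (I : P → L → Prop) (p q : P) : ℤ := Set.ncard {ℓ | I p ℓ ∧ I q ℓ}

theorem linesThrough_comm (p q : P) : linesThrough I p q = linesThrough I q p := by
  simp only [linesThrough, and_comm]

theorem linesThrough_self (h : IsProperPartialGeometry I s t α) (p : P) :
    linesThrough I p p = t + 1 := by
  simp only [linesThrough, and_self, h.lines_through_point p]
  push_cast; rfl

theorem linesThrough_eq_zero_or_one (h : IsProperPartialGeometry I s t α) {p q : P} (hpq : p ≠ q) :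
    linesThrough I p q = 0 ∨ linesThrough I p q = 1 := by
  have := h.finite_lines
  have h1 : Set.ncard {ℓ | I p ℓ ∧ I q ℓ} ≤ 1 := by
    rw [Set.ncard_le_one]
    intro ℓ hℓ m hm
    by_contra hne
    exact hpq (h.line_inter_line ℓ m hne p q hℓ.1 hm.1 hℓ.2 hm.2)
  simp only [linesThrough]
  omega

section Fintype

open Classical in
/-- The incidence matrix. -/
noncomputable def incidenceMatrix (I : P → L → Prop) (p : P) (ℓ : L) : ℤ := if I p ℓ then 1 else 0

theorem linesThrough_eq_sum [Fintype L] (p q : P) :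
    linesThrough I p q = ∑ ℓ, incidenceMatrix I p ℓ * incidenceMatrix I q ℓ := by
  classical
  simp only [incidenceMatrix, ← ite_and, mul_ite, mul_one, mul_zero]
  rw [Finset.sum_boole, linesThrough, ← Set.ncard_coe_finset]
  congr 2
  ext ℓ
  simp [and_comm]

theorem sum_incidenceMatrix_point [Fintype P] (h : IsProperPartialGeometry I s t α) (ℓ : L) :
    ∑ p, incidenceMatrix I p ℓ = s + 1 := by
  classical
  simp only [incidenceMatrix]
  rw [Finset.sum_boole]
  have := h.points_on_line ℓ
  rw [Set.ncard_eq_toFinset_card', Set.toFinset_ofPred] at this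
  exact_mod_cast this

theorem sum_incidenceMatrix_line [Fintype L] (h : IsProperPartialGeometry I s t α) (p : P) :
    ∑ ℓ, incidenceMatrix I p ℓ = t + 1 := by
  classical
  simp only [incidenceMatrix]
  rw [Finset.sum_boole]
  have := h.lines_through_point p
  rw [Set.ncard_eq_toFinset_card', Set.toFinset_ofPred] at this
  exact_mod_cast this

open Classical in
theorem sum_incidenceMatrix_mul_of_ne [Fintype P] (h : IsProperPartialGeometry I s t α) {ℓ m : L}
    (hm : m ≠ ℓ) :
    ∑ r, incidenceMatrix I r ℓ * incidenceMatrix I r m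
      = if ∃ y, I y m ∧ I y ℓ then 1 else 0 := by
  split_ifs with hy
  · obtain ⟨y, hym, hyl⟩ := hy
    rw [Finset.sum_eq_single y]
    · simp [incidenceMatrix, hym, hyl]
    · intro r _ hr
      by_contra h0
      apply hr
      apply h.line_inter_line m ℓ hm r y _ _ hym hyl <;>
        · by_contra h1
          simp [incidenceMatrix, h1] at h0
    · simp
  · refine Finset.sum_eq_zero fun r _ => ?_
    by_contra h0
    apply hy
    refine ⟨r, ?_, ?_⟩ <;>
      · by_contra h1
        simp [incidenceMatrix, h1] at h0

variable [Fintype P] [Fintype L]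

/-- The lines through `q`, counted with the number of points they share with `ℓ`. -/
theorem sum_incidenceMatrix_mul_sum (h : IsProperPartialGeometry I s t α) (q : P) (ℓ : L) :
    ∑ m, incidenceMatrix I q m * ∑ r, incidenceMatrix I r ℓ * incidenceMatrix I r m
      = (s + t + 1 - α) * incidenceMatrix I q ℓ + α := by
  classical
  by_cases hq : I q ℓ
  · have h1 : ∀ m, incidenceMatrix I q m * ∑ r, incidenceMatrix I r ℓ * incidenceMatrix I r m
        = incidenceMatrix I q m + if m = ℓ then (s : ℤ) else 0 := by
      intro m
      split_ifs with hm
      · subst hm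
        have : ∀ r, incidenceMatrix I r m * incidenceMatrix I r m = incidenceMatrix I r m := by
          intro r; simp [incidenceMatrix]
        simp_rw [this, h.sum_incidenceMatrix_point]
        simp [incidenceMatrix, hq]; ring
      · rw [h.sum_incidenceMatrix_mul_of_ne hm]
        by_cases hqm : I q m
        · rw [if_pos ⟨q, hqm, hq⟩]; simp
        · simp [incidenceMatrix, hqm]
    simp_rw [h1, Finset.sum_add_distrib, h.sum_incidenceMatrix_line]
    simp [incidenceMatrix, hq]; ring
  · have h1 : ∀ m, incidenceMatrix I q m * ∑ r, incidenceMatrix I r ℓ * incidenceMatrix I r m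
        = if I q m ∧ ∃ y, I y m ∧ I y ℓ then 1 else 0 := by
      intro m
      by_cases hqm : I q m
      · have hm : m ≠ ℓ := fun h0 => hq (h0 ▸ hqm)
        rw [h.sum_incidenceMatrix_mul_of_ne hm]
        simp [incidenceMatrix, hqm]
      · simp [incidenceMatrix, hqm]
    simp_rw [h1]
    rw [Finset.sum_boole]
    have := h.antiflag q ℓ hq
    rw [Set.ncard_eq_toFinset_card', Set.toFinset_ofPred] at this
    rw [this]
    simp [incidenceMatrix, hq]

/-- The square of the matrix `N Nᵀ`, for `N` the incidence matrix of the geometry. -/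
theorem sum_linesThrough_mul (h : IsProperPartialGeometry I s t α) (p q : P) :
    ∑ r, linesThrough I p r * linesThrough I r q
      = (s + t + 1 - α) * linesThrough I p q + α * (t + 1) := by
  calc ∑ r, linesThrough I p r * linesThrough I r q
      = ∑ ℓ, incidenceMatrix I p ℓ *
          ∑ m, incidenceMatrix I q m * ∑ r, incidenceMatrix I r ℓ * incidenceMatrix I r m := by
        simp_rw [linesThrough_eq_sum, Finset.sum_mul_sum, Finset.mul_sum]
        rw [Finset.sum_comm]
        refine Finset.sum_congr rfl fun ℓ _ => ?_
        rw [Finset.sum_comm]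
        refine Finset.sum_congr rfl fun m _ => Finset.sum_congr rfl fun r _ => by ring
    _ = _ := by
        simp_rw [h.sum_incidenceMatrix_mul_sum, linesThrough_eq_sum, mul_add,
          Finset.sum_add_distrib, ← Finset.sum_mul, h.sum_incidenceMatrix_line, Finset.mul_sum]
        rw [show (t + 1 : ℤ) * α = α * t + α * 1 by ring]
        congr 1
        exact Finset.sum_congr rfl fun ℓ _ => by ring

theorem sum_linesThrough (h : IsProperPartialGeometry I s t α) (p : P) :
    ∑ r, linesThrough I p r = (s + 1) * (t + 1) := by
  simp_rw [linesThrough_eq_sum]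
  rw [Finset.sum_comm]
  simp_rw [← Finset.mul_sum, h.sum_incidenceMatrix_point, ← Finset.sum_mul,
    h.sum_incidenceMatrix_line]
  ring

theorem card_lines_mul (h : IsProperPartialGeometry I s t α) :
    Fintype.card L * (s + 1) = Fintype.card P * (t + 1) := by
  have h1 : ∑ p, ∑ ℓ, incidenceMatrix I p ℓ = ∑ ℓ, ∑ p, incidenceMatrix I p ℓ := Finset.sum_comm
  simp_rw [h.sum_incidenceMatrix_point, h.sum_incidenceMatrix_line] at h1
  simp only [Finset.sum_const, Finset.card_univ, nsmul_eq_mul] at h1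
  exact_mod_cast h1.symm

end Fintype

end IsProperPartialGeometry

/-- A free action of a finite group on a finite set partitions it into orbits of full size. -/
theorem MulAction.card_dvd_card_of_stabilizer_eq_bot {G X : Type*} [Group G] [MulAction G X]
    (h : ∀ x : X, MulAction.stabilizer G x = ⊥) : Nat.card G ∣ Nat.card X := by
  rw [Nat.card_congr (MulAction.selfEquivSigmaOrbitsQuotientStabilizer G X)]
  have : ∀ ω : Quotient (MulAction.orbitRel G X),
      Nonempty ((G ⧸ MulAction.stabilizer G (Quotient.out ω)) ≃ G) := fun ω => by
    rw [h]; exact ⟨QuotientGroup.quotientBot.toEquiv⟩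
  rw [Nat.card_congr (Equiv.sigmaCongrRight fun ω => (this ω).some),
    Nat.card_congr (Equiv.sigmaEquivProd _ _), Nat.card_prod]
  exact dvd_mul_left _ _

namespace IsRigidPartialGeometry

open IsProperPartialGeometry

variable {G P L : Type*} [CommGroup G] [MulAction G P] [MulAction G L] {I : P → L → Prop}
  {s t α : ℕ}

/-- The identification of a Singer group with the points of the geometry. -/
noncomputable def pointEquiv (h : IsRigidPartialGeometry G I s t α) (p₀ : P) : G ≃ P :=
  Equiv.ofBijective (fun g => g • p₀) ⟨fun _ g' hg =>
    (h.singer.sharply_transitive p₀ (g' • p₀)).unique hg rfl,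
    fun q => (h.singer.sharply_transitive p₀ q).exists⟩

theorem linesThrough_smul (h : IsRigidPartialGeometry G I s t α) (g : G) (p q : P) :
    linesThrough I (g • p) (g • q) = linesThrough I p q := by
  rw [linesThrough, linesThrough, ← Set.ncard_image_of_injective
    {ℓ | I p ℓ ∧ I q ℓ} (MulAction.injective g)]
  congr 2
  ext ℓ
  simp only [Set.mem_ofPred_eq, Set.mem_image]
  constructor
  · intro hℓ
    refine ⟨g⁻¹ • ℓ, ?_, by simp⟩
    rw [← h.singer.smul_incident_iff g, ← h.singer.smul_incident_iff g q]
    simpa using hℓ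
  · rintro ⟨m, hm, rfl⟩
    simpa only [h.singer.smul_incident_iff] using hm

theorem isCollinearityFunction (h : IsRigidPartialGeometry G I s t α) [Fintype G] (p₀ : P) :
    IsCollinearityFunction (A := Additive G) (fun g => linesThrough I p₀ (g.toMul • p₀)) s t α := by
  have := h.partialGeometry.finite_points
  have := h.partialGeometry.finite_lines
  have : Fintype P := Fintype.ofFinite _
  have : Fintype L := Fintype.ofFinite _
  refine ⟨?_, ?_, ?_, ?_, ?_, h.partialGeometry.alpha_pos, ?_, ?_⟩
  · intro g
    rw [← h.partialGeometry.sum_linesThrough_mul p₀ (g.toMul • p₀),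
      ← ((Additive.toMul (α := G)).trans (h.pointEquiv p₀)).sum_comp]
    refine Finset.sum_congr rfl fun a _ => ?_
    show _ = linesThrough I p₀ (a.toMul • p₀) * linesThrough I (a.toMul • p₀) (g.toMul • p₀)
    congr 1
    have h1 := h.linesThrough_smul a.toMul p₀ ((g - a).toMul • p₀)
    rw [smul_smul, ← toMul_add, add_sub_cancel] at h1
    exact h1.symm
  · simpa using h.partialGeometry.linesThrough_self p₀
  · intro g hg
    apply h.partialGeometry.linesThrough_eq_zero_or_one
    intro h0
    apply hg
    have := (h.pointEquiv p₀).injective (a₁ := 1) (a₂ := g.toMul)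
      (show (1 : G) • p₀ = g.toMul • p₀ by rw [one_smul, ← h0])
    exact Additive.toMul.injective this.symm
  · intro g
    rw [← h.linesThrough_smul g.toMul, linesThrough_comm]
    simp
  · rw [← h.partialGeometry.sum_linesThrough p₀,
      ← ((Additive.toMul (α := G)).trans (h.pointEquiv p₀)).sum_comp]
    rfl
  · exact lt_of_lt_of_le h.partialGeometry.alpha_lt (min_le_left _ _)
  · exact lt_of_lt_of_le h.partialGeometry.alpha_lt (min_le_right _ _)

theorem succ_dvd_succ (h : IsRigidPartialGeometry G I s t α) : s + 1 ∣ t + 1 := by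
  have := h.partialGeometry.finite_points
  have := h.partialGeometry.finite_lines
  have : Fintype P := Fintype.ofFinite _
  have : Fintype L := Fintype.ofFinite _
  obtain ⟨p₀⟩ := h.partialGeometry.nonempty_points
  have h1 := MulAction.card_dvd_card_of_stabilizer_eq_bot h.rigid
  rw [Nat.card_congr (h.pointEquiv p₀), Nat.card_eq_fintype_card, Nat.card_eq_fintype_card] at h1
  obtain ⟨k, hk⟩ := h1
  have h2 := h.partialGeometry.card_lines_mul
  rw [hk, mul_assoc] at h2
  have h3 : 0 < Fintype.card P := Fintype.card_pos_iff.2 ⟨p₀⟩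
  exact ⟨k, by rw [← Nat.eq_of_mul_eq_mul_left h3 h2, mul_comm]⟩

end IsRigidPartialGeometry

/-! ### Search for parameters -/

namespace ParameterSearch

/-- Whether `f` holds at `1, …, n`. -/
def allUpTo (f : ℕ → Bool) (n : ℕ) : Bool := Nat.rec true (fun m ih => f (Nat.succ m) && ih) n

/-- `f x`, written as a recursion on `x` so that the kernel evaluates `x` before unfolding `f`. -/
def force (x : ℕ) (f : ℕ → Bool) : Bool := Nat.rec (f 0) (fun m _ => f (Nat.succ m)) x

theorem force_eq (x : ℕ) (f : ℕ → Bool) : force x f = f x := by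
  cases x <;> rfl

theorem allUpTo_spec {f : ℕ → Bool} {n : ℕ} (h : allUpTo f n = true) {m : ℕ} (hm : 0 < m)
    (hmn : m ≤ n) : f m = true := by
  induction n with
  | zero => omega
  | succ n ih =>
    have h' : (f (n + 1) && allUpTo f n) = true := h
    rw [Bool.and_eq_true] at h'
    rcases Nat.lt_or_ge n m with h1 | h1
    · rw [show m = n + 1 by omega]; exact h'.1
    · exact ih h'.2 h1

/-- The parameters `(s + 1, (t + 1) / (s + 1), α + 1)` with `α ≤ 1000` that satisfy the divisibility
conditions and lie outside the family `α = k + 1`, `s + 1 = α (α + 1)`. -/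
def sporadic : List (ℕ × ℕ × ℕ) :=
  [(40, 1, 16), (165, 2, 45), (840, 2, 70), (456, 3, 96), (945, 3, 105), (273, 1, 105),
   (374, 2, 154), (1015, 4, 175), (1968, 5, 288), (880, 3, 320), (7920, 4, 396), (3465, 6, 441),
   (2296, 2, 616), (5680, 7, 640), (1628, 3, 704), (1870, 1, 715), (1395, 34, 775), (8811, 8, 891)]

/-- Whether `(c, d, g, j, k)` violates a divisibility condition or yields known parameters. Here
`gc = g * c` and `cd = c * d`, and the tuple stands for the parameters `α + 1 = c d M`,
`s + 1 = c M y`, `t + 1 = g k (s + 1)`, `n = k c M ^ 2` with `y = d + j k` and `M = g y + j`; see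
`exists_parametrization`. Then `α` divides `z = y (g c y ^ 2 - 1)`, and `|P| = n c M (z / α)`. As
the prime divisors of `|P|` divide `n`, and `z / α < 2 ^ 30`, the number `z / α` divides
`(k c M) ^ 30`. The family with `c = d = g = j = 1` passes. -/
def tupleCheck (c d g j k gc cd : ℕ) : Bool :=
  force (Nat.add d (Nat.mul j k)) fun y => force (Nat.add (Nat.mul g y) j) fun M =>
    force (Nat.pred (Nat.mul cd M)) fun α =>
      force (Nat.mul y (Nat.pred (Nat.mul gc (Nat.mul y y)))) fun z =>
        bif Nat.beq (Nat.mod z α) 0 then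
          bif Nat.beq (Nat.mod ((k * c * M) ^ 30) (Nat.div z α)) 0 then
            Nat.beq (c * d * g * j) 1 ||
              sporadic.any fun x => x.1.beq (c * M * y) && x.2.1.beq (g * k) && x.2.2.beq (cd * M)
          else true
        else true

/-- `tupleCheck` for all `(c, d, g, j, k)` with `c d (g (d + j k) + j) ≤ N`. -/
def searchUpTo (N : ℕ) : Bool :=
  allUpTo (fun c => allUpTo (fun d => force (Nat.mul c d) fun cd => force (Nat.div N cd) fun D =>
    allUpTo (fun g => force (Nat.mul g c) fun gc => force (Nat.sub D (Nat.mul g d)) fun B =>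
      allUpTo (fun j => allUpTo (fun k => tupleCheck c d g j k gc cd)
        (Nat.div (Nat.sub B j) (Nat.mul g j))) (Nat.div B (Nat.succ g)))
          (Nat.div D (Nat.succ d))) (Nat.div N c)) N

set_option maxRecDepth 100000 in
theorem searchUpTo_eq_true : searchUpTo 1001 = true := by decide +kernel

theorem tupleCheck_eq_true {c d g j k : ℕ} (hc : 0 < c) (hd : 0 < d) (hg : 0 < g) (hj : 0 < j)
    (hk : 0 < k) (hN : c * d * (g * (d + j * k) + j) ≤ 1001) :
    tupleCheck c d g j k (g * c) (c * d) = true := by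
  have hcd : 0 < c * d := Nat.mul_pos hc hd
  have hgj : g ≤ g * j := Nat.le_mul_of_pos_right g hj
  have hgjk : g * j ≤ g * j * k := Nat.le_mul_of_pos_right _ hk
  have hD : g * (d + j * k) + j ≤ 1001 / (c * d) := by
    rw [Nat.le_div_iff_mul_le hcd, mul_comm]; exact hN
  have hD' : g * d + g * j * k + j ≤ 1001 / (c * d) := by
    refine le_trans (le_of_eq ?_) hD; ring
  have h1 := searchUpTo_eq_true
  have hcN : c * d ≤ 1001 := le_trans (Nat.le_mul_of_pos_right _ (by omega)) hN
  have h2 := allUpTo_spec h1 hc (le_trans (Nat.le_mul_of_pos_right c hd) hcN)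
  have h3 := allUpTo_spec h2 hd (by
    show d ≤ 1001 / c
    rw [Nat.le_div_iff_mul_le hc, mul_comm]; exact hcN)
  simp only [force_eq] at h3
  have h4 := allUpTo_spec h3 hg (by
    show g ≤ 1001 / (c * d) / (d + 1)
    rw [Nat.le_div_iff_mul_le (Nat.succ_pos d)]
    linarith)
  have h5 := allUpTo_spec h4 hj (by
    show j ≤ (1001 / (c * d) - g * d) / (g + 1)
    rw [Nat.le_div_iff_mul_le (Nat.succ_pos g)]
    apply Nat.le_sub_of_add_le
    linarith)
  exact allUpTo_spec h5 hk (by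
    show k ≤ (1001 / (c * d) - g * d - j) / (g * j)
    rw [Nat.le_div_iff_mul_le (Nat.mul_pos hg hj)]
    apply Nat.le_sub_of_add_le
    apply Nat.le_sub_of_add_le
    linarith)

/-- If every prime divisor of `β` divides `N`, then `β` divides a power of `N`. -/
theorem dvd_pow_of_forall_prime_dvd {β N m : ℕ} (hβ : β < 2 ^ m) (hN : N ≠ 0)
    (h : ∀ p, p.Prime → p ∣ β → p ∣ N) : β ∣ N ^ m := by
  rcases Nat.eq_zero_or_pos β with h0 | h0
  · subst h0
    exact absurd (h _ (Nat.exists_prime_gt_modEq_one (k := 1) N one_ne_zero).choose_spec.1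
      (dvd_zero _)) (Nat.not_dvd_of_pos_of_lt (Nat.pos_of_ne_zero hN)
        (Nat.exists_prime_gt_modEq_one (k := 1) N one_ne_zero).choose_spec.2.1)
  rw [← Nat.factorization_le_iff_dvd h0.ne' (pow_ne_zero _ hN)]
  intro p
  rw [Nat.factorization_pow, Finsupp.smul_apply, smul_eq_mul]
  by_cases hp : p.Prime ∧ p ∣ β
  · have h1 : 1 ≤ N.factorization p :=
      (hp.1.dvd_iff_one_le_factorization hN).1 (h p hp.1 hp.2)
    have h2 : 2 ^ β.factorization p < 2 ^ m :=
      calc 2 ^ β.factorization p ≤ p ^ β.factorization p := Nat.pow_le_pow_left hp.1.two_le _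
        _ ≤ β := Nat.ordProj_le p h0.ne'
        _ < 2 ^ m := hβ
    have h3 := (Nat.pow_lt_pow_iff_right (by norm_num : 1 < 2)).1 h2
    nlinarith
  · have : β.factorization p = 0 := by
      rw [Nat.factorization_eq_zero_iff]; tauto
    omega

/-- Solutions of `w ∣ f ^ 2 * k`: remove `g = gcd(w, k)`, and let `d ^ 2` be the square part of
`w / g`. -/
theorem exists_of_dvd_sq_mul {w f k : ℕ} (hw : 0 < w) (hf : 0 < f)
    (h : w ∣ f ^ 2 * k) : ∃ c d g j k', w = g * (c * d ^ 2) ∧ k = g * k' ∧ f = c * d * j := by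
  obtain ⟨w', k', hcop, hw', hk'⟩ := Nat.exists_coprime w k
  set g := Nat.gcd w k with hg
  have hg0 : 0 < g := Nat.gcd_pos_of_pos_left _ hw
  have h1 : w' ∣ f ^ 2 := by
    have h2 : w' * g ∣ f ^ 2 * k' * g := by
      rw [mul_assoc, ← hw', ← hk']; exact h
    exact hcop.dvd_of_dvd_mul_right (Nat.dvd_of_mul_dvd_mul_right hg0 h2)
  obtain ⟨c, d, hcd, hc⟩ := Nat.sq_mul_squarefree w'
  have h2 : d ∣ f := by
    rw [← Nat.pow_dvd_pow_iff (n := 2) two_ne_zero]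
    exact (Dvd.intro _ hcd).trans h1
  obtain ⟨f', rfl⟩ := h2
  have hd : 0 < d := Nat.pos_of_mul_pos_right hf
  have h3 : c ∣ f' := by
    have : d ^ 2 * c ∣ d ^ 2 * f' ^ 2 := by rw [hcd, ← mul_pow]; exact h1
    exact (hc.dvd_pow_iff_dvd two_ne_zero).1 (Nat.dvd_of_mul_dvd_mul_left (by positivity) this)
  obtain ⟨j, rfl⟩ := h3
  refine ⟨c, d, g, j, k', ?_, ?_, ?_⟩
  · rw [mul_comm c, hcd, mul_comm]; exact hw'
  · rw [mul_comm]; exact hk'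
  · ring

/-- The solutions of the first divisibility condition, in terms of `w = k A ^ 2 / n`. The numbers
`x = u w / A` and `f = A - x` satisfy `x = w + f k` and `w ∣ f ^ 2 k`. -/
theorem exists_parametrization {u k A n : ℕ} (hk : 0 < k) (hA : 2 ≤ A) (hAu : A < u)
    (hn : n + A = (k + 1) * u) (hnk : n ∣ k * u ^ 2) :
    ∃ c d g j k' y M, 0 < c ∧ 0 < d ∧ 0 < g ∧ 0 < j ∧ 0 < k' ∧ y = d + j * k' ∧ M = g * y + j ∧
      k = g * k' ∧ A = c * d * M ∧ u = c * M * y ∧ n = k' * c * M ^ 2 := by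
  have hn0 : 0 < n := by nlinarith
  -- `n` divides `k A²` since `(k + 1) u ≡ A` modulo `n`
  have h1 : n ∣ k * A ^ 2 := by
    have h2 : n ∣ k * (n + A) ^ 2 := by
      rw [hn, show k * ((k + 1) * u) ^ 2 = (k + 1) ^ 2 * (k * u ^ 2) by ring]
      exact Dvd.dvd.mul_left hnk _
    rw [show k * (n + A) ^ 2 = n * (k * (n + 2 * A)) + k * A ^ 2 by ring] at h2
    exact (Nat.dvd_add_right (dvd_mul_right _ _)).1 h2
  obtain ⟨w, hw⟩ := h1
  obtain ⟨r, hr⟩ := hnk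
  have hw0 : 0 < w := by
    rcases Nat.eq_zero_or_pos w with h0 | h0
    · subst h0
      have : 0 < k * A ^ 2 := by positivity
      omega
    · exact h0
  have h2 : w * u ^ 2 = A ^ 2 * r := by
    apply Nat.eq_of_mul_eq_mul_left hk
    calc k * (w * u ^ 2) = w * (k * u ^ 2) := by ring
      _ = n * w * r := by rw [hr]; ring
      _ = k * (A ^ 2 * r) := by rw [← hw]; ring
  have h3 : A ∣ u * w := by
    rw [← Nat.pow_dvd_pow_iff (n := 2) two_ne_zero,
      show (u * w) ^ 2 = w * (w * u ^ 2) by ring, h2]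
    exact ⟨w * r, by ring⟩
  obtain ⟨x, hx⟩ := h3
  have h4 : k * A ^ 2 + A * w = (k + 1) * (A * x) := by
    rw [← hx, hw, show n * w + A * w = (n + A) * w by ring, hn]; ring
  have h5 : k * A + w = (k + 1) * x := by
    apply Nat.eq_of_mul_eq_mul_left (show 0 < A by omega)
    linarith
  have h6 : w < x := by
    have : A * w < A * x := by rw [← hx]; exact Nat.mul_lt_mul_of_pos_right hAu hw0
    exact Nat.lt_of_mul_lt_mul_left this
  have h7 : x < A := by
    by_contra hcon
    have : k * A ≤ k * x := Nat.mul_le_mul_left k (not_lt.1 hcon)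
    nlinarith
  obtain ⟨f, hfpos, hf⟩ : ∃ f, 0 < f ∧ A = x + f := ⟨A - x, by omega, by omega⟩
  have hxw : x = w + f * k := by
    rw [hf] at h5; linarith
  have h8 : w ∣ x ^ 2 := by
    refine ⟨r, ?_⟩
    apply Nat.eq_of_mul_eq_mul_left (show 0 < A ^ 2 by positivity)
    calc A ^ 2 * x ^ 2 = (A * x) ^ 2 := by ring
      _ = w * (w * u ^ 2) := by rw [← hx]; ring
      _ = A ^ 2 * (w * r) := by rw [h2]; ring
  have h9 : w ∣ f ^ 2 * k := by
    have h10 : w ∣ A * x := ⟨u, by rw [← hx]; ring⟩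
    have h11 : w ∣ f ^ 2 * k ^ 2 := by
      rw [hxw, show (w + f * k) ^ 2 = w * (w + 2 * f * k) + f ^ 2 * k ^ 2 by ring] at h8
      exact (Nat.dvd_add_right (dvd_mul_right _ _)).1 h8
    rw [hf, hxw, show (w + f * k + f) * (w + f * k)
      = w * (w + 2 * f * k + f) + f ^ 2 * k ^ 2 + f ^ 2 * k by ring] at h10
    exact (Nat.dvd_add_right (dvd_add (dvd_mul_right _ _) h11)).1 h10
  obtain ⟨c, d, g, j, k', hw', hk', hf_eq⟩ := exists_of_dvd_sq_mul hw0 hfpos h9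
  have hg0 : 0 < g := Nat.pos_of_mul_pos_right (hw' ▸ hw0)
  have hk0 : 0 < k' := Nat.pos_of_mul_pos_left (hk' ▸ hk)
  have hf0 : 0 < c * d * j := by rw [← hf_eq]; exact hfpos
  have hj0 : 0 < j := Nat.pos_of_mul_pos_left hf0
  have hcd0 : 0 < c * d := Nat.pos_of_mul_pos_right hf0
  have hc0 : 0 < c := Nat.pos_of_mul_pos_right hcd0
  have hd0 : 0 < d := Nat.pos_of_mul_pos_left hcd0
  obtain ⟨y, hy⟩ : ∃ y, y = d + j * k' := ⟨_, rfl⟩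
  obtain ⟨M, hM⟩ : ∃ M, M = g * y + j := ⟨_, rfl⟩
  have hy2 : 2 ≤ y := by
    have : 0 < j * k' := Nat.mul_pos hj0 hk0
    omega
  have hM0 : 0 < M := by omega
  have hxe : x = g * c * d * y := by rw [hxw, hw', hk', hf_eq, hy]; ring
  have hAe : A = c * d * M := by rw [hf, hxe, hf_eq, hM]; ring
  have hue : u = c * M * y := by
    apply Nat.eq_of_mul_eq_mul_right hw0
    rw [hx, hxe, hAe, hw']; ring
  have hne : n = k' * c * M ^ 2 := by
    apply Nat.eq_of_mul_eq_mul_right hw0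
    rw [← hw, hk', hAe, hw']; ring
  exact ⟨c, d, g, j, k', y, M, hc0, hd0, hg0, hj0, hk0, hy, hM, hk', hAe, hue, hne⟩

/-- The divisibility conditions on `u = s + 1`, `k = (t + 1) / (s + 1)`, `A = α + 1`,
`n = s + t + 1 - α` and `v = |P|` leave a one-parameter family and a finite list. -/
theorem parameters_of_dvd {u k A n v : ℕ} (hk : 0 < k) (hA : 2 ≤ A) (hAu : A < u) (hA' : A ≤ 1001)
    (hn : n + A = (k + 1) * u) (hnk : n ∣ k * u ^ 2) (hnv : n ∣ v)
    (hv : v * (A - 1) + u * n = u * (k * u ^ 2)) (hp : ∀ p, p.Prime → p ∣ v → p ∣ n) :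
    (A = k + 2 ∧ u = A * (A - 1)) ∨ (u, k, A) ∈ sporadic := by
  have hn0 : 0 < n := by nlinarith
  obtain ⟨c, d, g, j, k', y, M, hc0, hd0, hg0, hj0, hk0, hy, hM, hk', hAe, hue, hne⟩ :=
    exists_parametrization hk hA hAu hn hnk
  have key := tupleCheck_eq_true hc0 hd0 hg0 hj0 hk0
  have hy2 : 2 ≤ y := by
    have : 0 < j * k' := Nat.mul_pos hj0 hk0
    omega
  have hM0 : 0 < M := by omega
  obtain ⟨z, hz⟩ := hnv
  have hgcy : 0 < g * c * (y * y) := by positivity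
  have hgcy4 : 4 ≤ g * c * (y * y) := by
    have h0 : 1 ≤ g * c := Nat.mul_pos hg0 hc0
    have h1 : 2 * 2 ≤ y * y := Nat.mul_le_mul hy2 hy2
    exact Nat.mul_le_mul h0 h1
  obtain ⟨W, hW⟩ : ∃ W, g * c * (y * y) = W + 1 := ⟨_, (Nat.sub_add_cancel hgcy).symm⟩
  obtain ⟨a, ha⟩ : ∃ a, A = a + 1 := ⟨A - 1, by omega⟩
  have hz2 : z * a = c * M * (y * W) := by
    have h10 : n * (z * a) + n * u = n * (u * (W + 1)) := by
      calc n * (z * a) + n * u = v * (A - 1) + u * n := by rw [hz, ha]; simp; ring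
        _ = u * (k * u ^ 2) := hv
        _ = n * (u * (W + 1)) := by rw [← hW, hne, hk', hue]; ring
    have h11 : z * a + u = u * (W + 1) := by
      apply Nat.eq_of_mul_eq_mul_left hn0
      linarith
    have : z * a = u * W := by linarith
    rw [this, hue]; ring
  have hcop : Nat.Coprime a (c * M) := by
    have h10 : Nat.Coprime a A := by rw [ha]; simp
    refine Nat.Coprime.coprime_dvd_right ?_ h10
    exact ⟨d, by rw [hAe]; ring⟩
  have hdvd : a ∣ y * W := hcop.dvd_of_dvd_mul_left ⟨z, by rw [← hz2]; ring⟩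
  obtain ⟨β, hβ⟩ := hdvd
  have ha0 : 0 < a := by omega
  have hzβ : z = c * M * β := by
    apply Nat.eq_of_mul_eq_mul_right ha0
    rw [hz2, hβ]; ring
  have hβN : β ∣ (k' * c * M) ^ 30 := by
    apply dvd_pow_of_forall_prime_dvd
    · have h10 : β ≤ y * W := by rw [hβ]; exact Nat.le_mul_of_pos_left _ ha0
      have h11 : c * d * (g * y) ≤ 1001 := by
        have : c * d * (g * y) ≤ c * d * M := Nat.mul_le_mul_left _ (by omega)
        omega
      have h12 : y ≤ 1001 := by
        have : 1 * y ≤ c * d * g * y := Nat.mul_le_mul_right y (by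
          have : 0 < c * d * g := by positivity
          omega)
        have : 1 * y ≤ 1001 := this.trans ((le_of_eq (by ring)).trans h11)
        omega
      have h13 : g * c * y ≤ 1001 := by
        have : g * c * y * 1 ≤ g * c * y * d := Nat.mul_le_mul_left _ hd0
        rw [mul_one] at this
        exact this.trans ((le_of_eq (by ring)).trans h11)
      have h14 : y * W ≤ y * (g * c * (y * y)) := Nat.mul_le_mul_left _ (by omega)
      calc β ≤ g * c * y * (y * y) := by
            refine h10.trans (h14.trans (le_of_eq ?_)); ring
        _ ≤ 1001 * (1001 * 1001) := by gcongr
        _ < 2 ^ 30 := by norm_num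
    · positivity
    · intro p hpp hpβ
      have h10 : p ∣ n := hp p hpp (by
        rw [hz, hzβ]; exact Dvd.dvd.mul_left (Dvd.dvd.mul_left hpβ _) _)
      rw [hne, show k' * c * M ^ 2 = k' * c * M * M by ring] at h10
      rcases hpp.dvd_mul.1 h10 with h11 | h11
      · exact h11
      · exact Dvd.dvd.mul_left h11 _
  have hk2 := key (by rw [← hy, ← hM, ← hAe]; exact hA')
  have hk3 : tupleCheck c d g j k' (g * c) (c * d)
      = bif Nat.beq (y * (g * c * (y * y) - 1) % (c * d * M - 1)) 0 then
          bif Nat.beq ((k' * c * M) ^ 30 % (y * (g * c * (y * y) - 1) / (c * d * M - 1))) 0 then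
            Nat.beq (c * d * g * j) 1 || sporadic.any fun x =>
              x.1.beq (c * M * y) && x.2.1.beq (g * k') && x.2.2.beq (c * d * M)
          else true
        else true := by
    simp only [tupleCheck, force_eq, hM, hy]; rfl
  rw [hk3, ← hAe, ← hue, ← hk', hW, ha, Nat.add_sub_cancel, Nat.add_sub_cancel, hβ,
    Nat.mul_mod_right, Nat.mul_div_cancel_left _ ha0, Nat.mod_eq_zero_of_dvd hβN] at hk2
  simp only [Nat.beq_refl, cond_true, Bool.or_eq_true, List.any_eq_true,
    Bool.and_eq_true] at hk2
  rcases hk2 with h10 | ⟨⟨a₁, a₂, a₃⟩, h10, ⟨h11, h12⟩, h13⟩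
  · left
    obtain ⟨⟨⟨rfl, rfl⟩, rfl⟩, rfl⟩ : ((c = 1 ∧ d = 1) ∧ g = 1) ∧ j = 1 := by
      simpa only [mul_eq_one] using Nat.eq_of_beq_eq_true h10
    have hAk : A = k + 2 := by rw [hAe, hM, hy, hk']; ring
    refine ⟨hAk, ?_⟩
    rw [hue, hAk, show k + 2 - 1 = k + 1 from rfl, hM, hy, hk']; ring
  · right
    rw [ha, ← Nat.eq_of_beq_eq_true h11, ← Nat.eq_of_beq_eq_true h12,
      ← Nat.eq_of_beq_eq_true h13]
    exact h10

end ParameterSearch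

/-! ### Projection modulo Sylow subgroups -/

theorem AddSubgroup.exists_card_eq_prime_pow {A : Type*} [AddCommGroup A] [Fintype A] {p c q : ℕ}
    (hp : p.Prime) (hA : Fintype.card A = p ^ c * q) (hq : p.Coprime q) :
    ∃ H : AddSubgroup A, Nat.card H = p ^ c ∧ H.index = q := by
  have : Fact p.Prime := ⟨hp⟩
  obtain ⟨P⟩ : Nonempty (Sylow p (Multiplicative A)) := inferInstance
  let H : AddSubgroup A := Subgroup.toAddSubgroup' P.toSubgroup
  have hcard : Nat.card H = p ^ c := by
    have h1 : Nat.card H = Nat.card P := rfl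
    have hq0 : q ≠ 0 := by
      rintro rfl
      have : 0 < Fintype.card A := Fintype.card_pos
      omega
    have h2 : Nat.card (Multiplicative A) = p ^ c * q := by
      rw [← hA, ← Nat.card_eq_fintype_card]; rfl
    rw [h1, P.card_eq_multiplicity, h2, Nat.factorization_mul (pow_ne_zero _ hp.ne_zero) hq0,
      Finsupp.add_apply, hp.factorization_pow, Finsupp.single_eq_same,
      Nat.factorization_eq_zero_of_not_dvd ((Nat.Prime.coprime_iff_not_dvd hp).1 hq), add_zero]
  refine ⟨H, hcard, ?_⟩
  have h1 := H.card_mul_index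
  rw [hcard, Nat.card_eq_fintype_card, hA] at h1
  exact Nat.eq_of_mul_eq_mul_left (pow_pos hp.pos _) h1

/-- A finite set stable under a map whose square is a fixed-point-free negation decomposes into
cycles of length four. -/
theorem four_dvd_card_of_sq_eq_neg {A : Type*} [AddCommGroup A] (S : Finset A) (J : A → A)
    (hJ : ∀ g ∈ S, J g ∈ S) (hJJ : ∀ g ∈ S, J (J g) = -g) (hneg : ∀ g ∈ S, -g ≠ g) :
    4 ∣ S.card := by
  rcases S.eq_empty_or_nonempty with rfl | ⟨g₀, hg₀⟩
  · simp
  let f : S → S := fun g => ⟨J g, hJ g g.2⟩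
  have hf4 : ∀ g, f (f (f (f g))) = g := by
    intro g
    apply Subtype.ext
    show J (J (J (J g))) = g
    have h1 : -(g : A) ∈ S := by rw [← hJJ g g.2]; exact hJ _ (hJ _ g.2)
    rw [hJJ g g.2, hJJ _ h1, neg_neg]
  let σ : Equiv.Perm S := ⟨f, fun g => f (f (f g)), hf4, hf4⟩
  have hσ4 : σ ^ 4 = 1 := by
    ext g; exact congrArg Subtype.val (hf4 g)
  have hσ2 : ∀ g, (σ ^ 2) g ≠ g := by
    intro g hg
    apply hneg g g.2
    rw [← hJJ g g.2]
    exact congrArg Subtype.val hg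
  have hord : orderOf σ = 2 ^ (1 + 1) := by
    refine orderOf_eq_prime_pow (p := 2) ?_ hσ4
    intro h1
    exact hσ2 ⟨g₀, hg₀⟩ (by rw [show σ ^ 2 = 1 from h1]; rfl)
  have hfree : ∀ g : S, MulAction.stabilizer (Subgroup.zpowers σ) g = ⊥ := by
    intro g
    rw [eq_bot_iff]
    rintro ⟨τ, i, rfl⟩ hi
    have hi' : (σ ^ i) g = g := hi
    have hσ4' : σ ^ (4 : ℤ) = 1 := by exact_mod_cast hσ4
    rw [Subgroup.mem_bot]
    apply Subtype.ext
    show σ ^ i = 1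
    by_cases h2 : (4 : ℤ) ∣ i
    · obtain ⟨m, rfl⟩ := h2
      rw [zpow_mul, hσ4', one_zpow]
    · exfalso
      have h3 : ∀ j : ℤ, (σ ^ (i * j)) g = g := by
        intro j
        rw [zpow_mul]
        have : σ ^ i ∈ MulAction.stabilizer (Equiv.Perm S) g := hi'
        exact Subgroup.zpow_mem _ this j
      obtain ⟨j, m, hjm⟩ : ∃ j m : ℤ, i * j = 2 + 4 * m := by
        rcases Int.emod_two_eq_zero_or_one i with h4 | h4
        · exact ⟨1, (i - 2) / 4, by omega⟩
        · rcases (by omega : i % 4 = 1 ∨ i % 4 = 3) with h5 | h5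
          · exact ⟨2, (i - 1) / 2, by omega⟩
          · exact ⟨2, (i - 1) / 2, by omega⟩
      apply hσ2 g
      have := h3 j
      rw [hjm, zpow_add, zpow_mul, hσ4', one_zpow, mul_one] at this
      exact_mod_cast this
  have h1 := MulAction.card_dvd_card_of_stabilizer_eq_bot hfree
  rw [Nat.card_zpowers, hord] at h1
  simpa using h1

namespace IsCollinearityFunction

variable {A : Type*} [AddCommGroup A] [Fintype A] {e : A → ℤ} {s t α : ℕ}

/-- The right hand side of `quotient_inequality` for a subgroup of order `m` and index `q`, as a
function of the value `b` of the projection of `e` at zero. -/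
def projectionBound (s t α m q a : ℕ) (Q b : ℤ) : ℤ :=
  (s + t + 1 - α) * b + m * (α * (t + 1)) - b ^ 2 - a * (2 * Q + 1) * ((s + 1) * (t + 1) - b)
    + (q - 1) * a ^ 2 * Q * (Q + 1)

/-- `quotient_inequality` for a Sylow `p`-subgroup `H` of order `p ^ c`. -/
theorem exists_sylow (h : IsCollinearityFunction e s t α) [DecidableEq A] {p c q a : ℕ}
    (hp : p.Prime) (hA : Fintype.card A = p ^ c * q) (hq : p.Coprime q)
    (ha : (a : ℤ) ∣ s + t + 1 - α) (haq : a.Coprime q) :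
    ∃ H : AddSubgroup A, Nat.card H = p ^ c ∧ ∃ d : ℕ,
      (∃ S : Finset A, S.card = d ∧ ∀ g, g ∈ S ↔ g ∈ H ∧ g ≠ 0 ∧ e g = 1) ∧
      d < p ^ c ∧ a ∣ t + 1 + d ∧
      ∀ Q : ℤ, 0 ≤ projectionBound s t α (p ^ c) q a Q (t + 1 + d : ℕ) := by
  classical
  obtain ⟨H, hH, hHi⟩ := AddSubgroup.exists_card_eq_prime_pow hp hA hq
  obtain ⟨hd, hb, hineq⟩ := h.quotient_inequality H ha (by rwa [hHi])
  refine ⟨H, hH, _, ⟨_, rfl, fun g => by simp⟩, hH ▸ hd, hb, fun Q => ?_⟩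
  have h1 := hineq Q
  rw [hH, hHi] at h1
  rw [projectionBound]
  push_cast at h1 ⊢
  exact h1

/-- There is no geometry if for some integer `Q` the inequality of `exists_sylow` fails for all
admissible values `a m` of the projection of `e` at zero. -/
theorem false_of_sylow (h : IsCollinearityFunction e s t α) {p c q : ℕ} (a : ℕ) (Q : ℤ)
    (hp : p.Prime) (hA : Fintype.card A = p ^ c * q) (hq : p.Coprime q)
    (ha : (a : ℤ) ∣ s + t + 1 - α) (haq : a.Coprime q) (ha0 : 0 < a)
    (hQ : ∀ m < p ^ c / a + 2, t + 1 ≤ a * ((t + 1) / a + m) →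
      projectionBound s t α (p ^ c) q a Q (a * ((t + 1) / a + m) : ℕ) < 0) :
    False := by
  classical
  obtain ⟨H, -, d, -, hd, ⟨b, hb⟩, hineq⟩ := h.exists_sylow hp hA hq ha haq
  have h1 := hineq Q
  have h2 : (t + 1) / a ≤ b := by
    rw [← Nat.mul_div_cancel_left b ha0, ← hb]
    exact Nat.div_le_div_right (by omega)
  have h3 : b < (t + 1) / a + (p ^ c / a + 2) := by
    have h4 := Nat.lt_div_mul_add (a := t + 1) ha0
    have h5 := Nat.lt_div_mul_add (a := p ^ c) ha0
    have h6 : a * b < a * ((t + 1) / a + (p ^ c / a + 2)) := by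
      rw [← hb]
      linarith
    exact Nat.lt_of_mul_lt_mul_left h6
  have h4 := hQ (b - (t + 1) / a) (by omega)
  rw [Nat.add_sub_cancel' h2, ← hb] at h4
  have h5 := h4 (by omega)
  omega

/-- The Sylow `5`-subgroup has `5` or `30` nonzero elements collinear with `0`; but their number is
divisible by four, as they are permuted by doubling. -/
theorem false_of_1869_1869_714 (h : IsCollinearityFunction e 1869 1869 714) : False := by
  classical
  have hcard : Fintype.card A = 5 ^ 4 * 14641 := by have := h.card_mul; push_cast at this; omega
  obtain ⟨H, hH, d, ⟨S, hSd, hS⟩, hd, ⟨b, hb⟩, hineq⟩ :=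
    h.exists_sylow (a := 25) Nat.prime_five hcard (by norm_num) (by norm_num) (by norm_num)
  have h1 : b < 100 := by omega
  have h2 : 75 ≤ b := by omega
  have h3 := hineq 9
  rw [hb] at h3
  have h4 : b = 75 ∨ b = 76 := by
    by_contra hne
    have : ∀ b < 100, 77 ≤ b →
        projectionBound 1869 1869 714 (5 ^ 4) 14641 25 9 (25 * b : ℕ) < 0 := by
      decide +kernel
    exact absurd h3 (not_le.2 (this b h1 (by omega)))
  have hdouble : ∀ g ∈ S, ∀ m : ℕ, 2 ^ m • g ∈ S := by
    intro g hg m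
    induction m with
    | zero => simpa using hg
    | succ m ih =>
      obtain ⟨h5, h6, h7⟩ := (hS _).1 ih
      have h8 : (2 : ℕ) • (2 ^ m • g) ≠ 0 := by
        intro h0
        apply h6
        have hcop : (Nat.card A).Coprime 2 := by
          rw [Nat.card_eq_fintype_card, hcard]; norm_num
        apply (nsmulCoprime hcop).injective
        show (2 : ℕ) • (2 ^ m • g) = (2 : ℕ) • 0
        rw [h0, smul_zero]
      have h9 := h.conv.two_nsmul_modEq (by rw [hcard]; decide) (by norm_num) (2 ^ m • g)
      rw [pow_succ', mul_smul]
      refine (hS _).2 ⟨H.nsmul_mem h5 2, h8, ?_⟩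
      rcases h.zero_or_one _ h8 with h10 | h10
      · rw [h7, h10] at h9; exact absurd h9 (by decide)
      · exact h10
  have h625 : ∀ g ∈ S, (625 : ℕ) • g = 0 := by
    intro g hg
    have : Nat.card H • (⟨g, ((hS g).1 hg).1⟩ : H) = 0 := card_nsmul_eq_zero'
    rw [hH] at this
    exact congrArg Subtype.val this
  -- `2 ^ 125` is a square root of `-1` modulo `625`
  have h5 : 4 ∣ S.card := by
    refine four_dvd_card_of_sq_eq_neg S (fun g => (2 ^ 125 : ℕ) • g) (fun g hg => hdouble g hg 125)
      (fun g hg => ?_) (fun g hg hneg => ?_)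
    · rw [eq_neg_iff_add_eq_zero, smul_smul, ← succ_nsmul,
        show 2 ^ 125 * 2 ^ 125 + 1 = (2 ^ 125 * 2 ^ 125 + 1) / 625 * 625 by norm_num, mul_smul,
        h625 g hg, smul_zero]
    · apply ((hS g).1 hg).2.1
      have h6 : (2 : ℕ) • g = 0 := by
        rw [two_nsmul]; nth_rewrite 1 [← hneg]; simp
      have h7 := h625 g hg
      rw [show 625 = 312 * 2 + 1 by norm_num, succ_nsmul, mul_smul, h6] at h7
      simpa using h7
  rw [hSd] at h5
  omega

end IsCollinearityFunction

/-! ### The parameters with `α ≤ 1000` -/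

namespace IsCollinearityFunction

variable {A : Type*} [AddCommGroup A] [Fintype A] {e : A → ℤ} {s t α : ℕ}

/-- The inequality of `exists_sylow` fails for `Q = 0` in the family considered below, where
`X = α - 1` and `B` is a prime power dividing `X`. -/
theorem family_bound_neg {X D B : ℤ} (hB : 2 ≤ B) (hBX : B ≤ X) (hD : 0 ≤ D) :
    (X + 1) * X * (X + 2) * ((B - 1) * ((X + 1) * B - (X + 2) * X))
      - D * (X * X * (X + 2) - B) - D ^ 2 < 0 := by
  have hX : 0 < X := by linarith
  have h3 : (X + 1) * B - (X + 2) * X < 0 := by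
    have : (X + 1) * B ≤ (X + 1) * X := mul_le_mul_of_nonneg_left hBX (by linarith)
    linarith
  have h4 : (B - 1) * ((X + 1) * B - (X + 2) * X) < 0 := mul_neg_of_pos_of_neg (by linarith) h3
  have h5 := mul_neg_of_pos_of_neg (show 0 < (X + 1) * X * (X + 2) by positivity) h4
  have h6 : B ≤ X * X * (X + 2) := by
    have h7 : X * 1 ≤ X * (X * (X + 2)) := mul_le_mul_of_nonneg_left (by nlinarith) hX.le
    linarith
  have h8 : 0 ≤ D * (X * X * (X + 2) - B) := mul_nonneg hD (by linarith)
  have h9 := sq_nonneg D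
  linarith

/-- In the family `α = k + 1`, `s + 1 = α (α + 1)`, where `|A| = n ^ 2` and
`n = (α + 1) ^ 2 (α - 1)`, an odd prime divisor of `α - 1` contradicts the inequality for `Q = 0`:
with `a` the exact power of the prime dividing `n`, it implies
`(a - 1) (α a - (α + 1) (α - 1)) ≥ 0`, although `1 < a ≤ α - 1`. -/
theorem false_of_odd_prime_dvd {x p : ℕ} (hp : p.Prime) (hp2 : p ≠ 2) (hpx : p ∣ x) (hx : 2 ≤ x)
    (h : IsCollinearityFunction e ((x + 2) * (x + 1) - 1) (x * ((x + 2) * (x + 1)) - 1) (x + 1)) :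
    False := by
  classical
  obtain ⟨i, y, hpy, hxy⟩ := Nat.exists_eq_pow_mul_and_not_dvd (n := x) (by omega) p hp.ne_one
  set a := p ^ i with ha
  have hi : i ≠ 0 := by
    rintro rfl
    rw [ha, pow_zero, one_mul] at hxy
    exact hpy (hxy ▸ hpx)
  have ha2 : 2 ≤ a := hp.two_le.trans (Nat.le_self_pow hi p)
  have hy0 : 0 < y := Nat.pos_of_ne_zero (by rintro rfl; simp at hpy)
  have hax : a ≤ x := by rw [hxy]; exact Nat.le_mul_of_pos_right _ hy0
  have hs : (((x + 2) * (x + 1) - 1 : ℕ) : ℤ) = (x + 2) * (x + 1) - 1 := by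
    rw [Nat.cast_sub (by nlinarith)]; push_cast; ring
  have ht : ((x * ((x + 2) * (x + 1)) - 1 : ℕ) : ℤ) = x * ((x + 2) * (x + 1)) - 1 := by
    rw [Nat.cast_sub (by nlinarith [Nat.zero_le (x * x), Nat.zero_le (x * x * x)])]; push_cast; ring
  have hn : (((x + 2) * (x + 1) - 1 : ℕ) : ℤ) + ((x * ((x + 2) * (x + 1)) - 1 : ℕ) : ℤ) + 1
      - ((x + 1 : ℕ) : ℤ) = (x + 2) ^ 2 * x := by
    rw [hs, ht]; push_cast; ring
  have hpx2 : ¬ p ∣ x + 2 := fun h2 => by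
    have : p ∣ 2 := (Nat.dvd_add_right hpx).1 h2
    exact hp2 ((Nat.prime_dvd_prime_iff_eq hp Nat.prime_two).1 this)
  have hcop : p.Coprime ((x + 2) ^ 4 * y ^ 2) :=
    Nat.Coprime.mul_right (Nat.Coprime.pow_right _ ((Nat.Prime.coprime_iff_not_dvd hp).2 hpx2))
      (Nat.Coprime.pow_right _ ((Nat.Prime.coprime_iff_not_dvd hp).2 hpy))
  have hcard : Fintype.card A = p ^ (i * 2) * ((x + 2) ^ 4 * y ^ 2) := by
    have h1 := h.card_mul
    rw [hs, ht] at h1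
    have h2 : ((x + 1 : ℕ) : ℤ) ≠ 0 := by positivity
    have h3 : (Fintype.card A : ℤ) = ((p ^ (i * 2) * ((x + 2) ^ 4 * y ^ 2) : ℕ) : ℤ) := by
      apply mul_right_cancel₀ h2
      rw [h1, pow_mul, ← ha]
      have hxy' : (x : ℤ) = a * y := by exact_mod_cast hxy
      push_cast
      rw [show (a : ℤ) ^ 2 * ((x + 2) ^ 4 * y ^ 2) = (x + 2) ^ 4 * (a * y) ^ 2 by ring, ← hxy']
      ring
    exact_mod_cast h3
  obtain ⟨H, -, d, -, -, -, hineq⟩ := h.exists_sylow (a := a) hp hcard hcop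
    (by rw [hn]; exact Dvd.dvd.mul_left (show (a : ℤ) ∣ x from ⟨y, by exact_mod_cast hxy⟩) _)
    (Nat.Coprime.pow_left _ hcop)
  have h1 := hineq 0
  rw [projectionBound, hn, pow_mul, ← ha] at h1
  push_cast [hs, ht] at h1
  have h2 := family_bound_neg (X := x) (D := d) (B := a) (by exact_mod_cast ha2)
    (by exact_mod_cast hax) (by positivity)
  refine absurd h1 (not_le.2 (lt_of_eq_of_lt ?_ h2))
  ring

/-- The parameters in `ParameterSearch.sporadic` for which a Singer group of rigid type is not
excluded. -/
theorem parameters_of_mem_sporadic {u k a : ℕ} (hs : (s + 1, k, α + 1) = (u, k, a))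
    (ht : t + 1 = k * (s + 1)) (hmem : (u, k, a) ∈ ParameterSearch.sporadic)
    (h : IsCollinearityFunction e s t α) :
    (s = 39 ∧ t = 39 ∧ α = 15) ∨ (s = 272 ∧ t = 272 ∧ α = 104) ∨
      (s = 2295 ∧ t = 4591 ∧ α = 615) := by
  simp only [Prod.mk.injEq, true_and] at hs
  simp only [ParameterSearch.sporadic, List.mem_cons, Prod.mk.injEq, List.not_mem_nil, or_false]
    at hmem
  have hcard := h.card_mul
  rcases hmem with ⟨rfl, rfl, rfl⟩ | ⟨rfl, rfl, rfl⟩ | ⟨rfl, rfl, rfl⟩ | ⟨rfl, rfl, rfl⟩ |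
    ⟨rfl, rfl, rfl⟩ | ⟨rfl, rfl, rfl⟩ | ⟨rfl, rfl, rfl⟩ | ⟨rfl, rfl, rfl⟩ | ⟨rfl, rfl, rfl⟩ |
    ⟨rfl, rfl, rfl⟩ | ⟨rfl, rfl, rfl⟩ | ⟨rfl, rfl, rfl⟩ | ⟨rfl, rfl, rfl⟩ | ⟨rfl, rfl, rfl⟩ |
    ⟨rfl, rfl, rfl⟩ | ⟨rfl, rfl, rfl⟩ | ⟨rfl, rfl, rfl⟩ | ⟨rfl, rfl, rfl⟩
  · left; omega
  · obtain ⟨rfl, rfl, rfl⟩ : s = 164 ∧ t = 329 ∧ α = 44 := by omega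
    exact (h.false_of_sylow (p := 2) (c := 2) (q := 50625) 2 0 Nat.prime_two
      (by push_cast at hcard; omega) (by norm_num) (by norm_num) (by norm_num) (by norm_num)
      (by decide +kernel)).elim
  · obtain ⟨rfl, rfl, rfl⟩ : s = 839 ∧ t = 1679 ∧ α = 69 := by omega
    exact (h.false_of_sylow (p := 7) (c := 3) (q := 50000) 49 0 (by norm_num)
      (by push_cast at hcard; omega) (by norm_num) (by norm_num) (by norm_num) (by norm_num)
      (by decide +kernel)).elim
  · obtain ⟨rfl, rfl, rfl⟩ : s = 455 ∧ t = 1367 ∧ α = 95 := by omega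
    exact (h.false_of_sylow (p := 3) (c := 6) (q := 4096) 27 5 Nat.prime_three
      (by push_cast at hcard; omega) (by norm_num) (by norm_num) (by norm_num) (by norm_num)
      (by decide +kernel)).elim
  · obtain ⟨rfl, rfl, rfl⟩ : s = 944 ∧ t = 2834 ∧ α = 104 := by omega
    exact (h.false_of_sylow (p := 5) (c := 3) (q := 194481) 25 0 Nat.prime_five
      (by push_cast at hcard; omega) (by norm_num) (by norm_num) (by norm_num) (by norm_num)
      (by decide +kernel)).elim
  · right; left; omega
  · obtain ⟨rfl, rfl, rfl⟩ : s = 373 ∧ t = 747 ∧ α = 153 := by omega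
    exact (h.false_of_sylow (p := 11) (c := 3) (q := 512) 121 4 (by norm_num)
      (by push_cast at hcard; omega) (by norm_num) (by norm_num) (by norm_num) (by norm_num)
      (by decide +kernel)).elim
  · obtain ⟨rfl, rfl, rfl⟩ : s = 1014 ∧ t = 4059 ∧ α = 174 := by omega
    exact (h.false_of_sylow (p := 2) (c := 4) (q := 1500625) 4 0 Nat.prime_two
      (by push_cast at hcard; omega) (by norm_num) (by norm_num) (by norm_num) (by norm_num)
      (by decide +kernel)).elim
  · obtain ⟨rfl, rfl, rfl⟩ : s = 1967 ∧ t = 9839 ∧ α = 287 := by omega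
    exact (h.false_of_sylow (p := 5) (c := 2) (q := 5308416) 5 0 Nat.prime_five
      (by push_cast at hcard; omega) (by norm_num) (by norm_num) (by norm_num) (by norm_num)
      (by decide +kernel)).elim
  · obtain ⟨rfl, rfl, rfl⟩ : s = 879 ∧ t = 2639 ∧ α = 319 := by omega
    exact (h.false_of_sylow (p := 2) (c := 11) (q := 3125) 128 5 Nat.prime_two
      (by push_cast at hcard; omega) (by norm_num) (by norm_num) (by norm_num) (by norm_num)
      (by decide +kernel)).elim
  · obtain ⟨rfl, rfl, rfl⟩ : s = 7919 ∧ t = 31679 ∧ α = 395 := by omega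
    exact (h.false_of_sylow (p := 11) (c := 3) (q := 3779136) 121 0 (by norm_num)
      (by push_cast at hcard; omega) (by norm_num) (by norm_num) (by norm_num) (by norm_num)
      (by decide +kernel)).elim
  · obtain ⟨rfl, rfl, rfl⟩ : s = 3464 ∧ t = 20789 ∧ α = 440 := by omega
    exact (h.false_of_sylow (p := 2) (c := 2) (q := 141776649) 2 0 Nat.prime_two
      (by push_cast at hcard; omega) (by norm_num) (by norm_num) (by norm_num) (by norm_num)
      (by decide +kernel)).elim
  · right; right; omega
  · obtain ⟨rfl, rfl, rfl⟩ : s = 5679 ∧ t = 39759 ∧ α = 639 := by omega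
    exact (h.false_of_sylow (p := 7) (c := 2) (q := 40960000) 7 0 (by norm_num)
      (by push_cast at hcard; omega) (by norm_num) (by norm_num) (by norm_num) (by norm_num)
      (by decide +kernel)).elim
  · obtain ⟨rfl, rfl, rfl⟩ : s = 1627 ∧ t = 4883 ∧ α = 703 := by omega
    exact (h.false_of_sylow (p := 11) (c := 3) (q := 13824) 121 4 (by norm_num)
      (by push_cast at hcard; omega) (by norm_num) (by norm_num) (by norm_num) (by norm_num)
      (by decide +kernel)).elim
  · obtain ⟨rfl, rfl, rfl⟩ : s = 1869 ∧ t = 1869 ∧ α = 714 := by omega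
    exact h.false_of_1869_1869_714.elim
  · obtain ⟨rfl, rfl, rfl⟩ : s = 1394 ∧ t = 47429 ∧ α = 774 := by omega
    exact (h.false_of_sylow (p := 5) (c := 3) (q := 953312) 25 2 Nat.prime_five
      (by push_cast at hcard; omega) (by norm_num) (by norm_num) (by norm_num) (by norm_num)
      (by decide +kernel)).elim
  · obtain ⟨rfl, rfl, rfl⟩ : s = 8810 ∧ t = 70487 ∧ α = 890 := by omega
    exact (h.false_of_sylow (p := 2) (c := 6) (q := 96059601) 8 0 Nat.prime_two
      (by push_cast at hcard; omega) (by norm_num) (by norm_num) (by norm_num) (by norm_num)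
      (by decide +kernel)).elim

/-- The members of the family `α = k + 1`, `s + 1 = α (α + 1)` without an odd prime divisor of
`α - 1`. The case `i = 1` is not excluded: it gives the parameters `(11, 23, 3)`. -/
theorem false_of_two_pow {i : ℕ} (hi : 2 ≤ i) (hi' : i ≤ 9)
    (h : IsCollinearityFunction e ((2 ^ i + 2) * (2 ^ i + 1) - 1)
      (2 ^ i * ((2 ^ i + 2) * (2 ^ i + 1)) - 1) (2 ^ i + 1)) : False := by
  have hcard := h.card_mul
  interval_cases i <;> norm_num at h hcard
  · exact h.false_of_sylow (p := 3) (c := 4) (q := 256) 9 1 Nat.prime_three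
      (by omega) (by norm_num) (by norm_num) (by norm_num) (by norm_num) (by decide +kernel)
  · exact h.false_of_sylow (p := 5) (c := 4) (q := 1024) 25 2 Nat.prime_five
      (by omega) (by norm_num) (by norm_num) (by norm_num) (by norm_num) (by decide +kernel)
  · exact h.false_of_sylow (p := 2) (c := 12) (q := 6561) 64 3 Nat.prime_two
      (by omega) (by norm_num) (by norm_num) (by norm_num) (by norm_num) (by decide +kernel)
  · exact h.false_of_sylow (p := 2) (c := 14) (q := 83521) 128 3 Nat.prime_two
      (by omega) (by norm_num) (by norm_num) (by norm_num) (by norm_num) (by decide +kernel)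
  · exact h.false_of_sylow (p := 3) (c := 4) (q := 959512576) 9 0 Nat.prime_three
      (by omega) (by norm_num) (by norm_num) (by norm_num) (by norm_num) (by decide +kernel)
  · exact h.false_of_sylow (p := 5) (c := 4) (q := 7487094784) 25 0 Nat.prime_five
      (by omega) (by norm_num) (by norm_num) (by norm_num) (by norm_num) (by decide +kernel)
  · exact h.false_of_sylow (p := 3) (c := 4) (q := 3584872677376) 9 0 Nat.prime_three
      (by omega) (by norm_num) (by norm_num) (by norm_num) (by norm_num) (by decide +kernel)
  · exact h.false_of_sylow (p := 2) (c := 22) (q := 4362470401) 2048 3 Nat.prime_two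
      (by omega) (by norm_num) (by norm_num) (by norm_num) (by norm_num) (by decide +kernel)

/-- The parameters of a proper partial geometry of rigid type with `α ≤ 1000`. -/
theorem parameters (h : IsCollinearityFunction e s t α) (hst : s + 1 ∣ t + 1) (hα : α ≤ 1000) :
    (s = 5 ∧ t = 5 ∧ α = 2) ∨ (s = 11 ∧ t = 23 ∧ α = 3) ∨ (s = 39 ∧ t = 39 ∧ α = 15) ∨
      (s = 272 ∧ t = 272 ∧ α = 104) ∨ (s = 2295 ∧ t = 4591 ∧ α = 615) := by
  obtain ⟨k, hk⟩ := hst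
  have hα0 := h.pos
  have hαs := h.lt_left
  have hk0 : 0 < k := Nat.pos_of_ne_zero (by rintro rfl; omega)
  obtain ⟨n, hn⟩ : ∃ n : ℕ, (n : ℤ) = s + t + 1 - α := ⟨s + t + 1 - α, by omega⟩
  have hkZ : (t + 1 : ℤ) = (s + 1) * k := by exact_mod_cast hk
  have hres := ParameterSearch.parameters_of_dvd (u := s + 1) (k := k) (A := α + 1) (n := n)
    (v := Fintype.card A) hk0 (by omega) (by omega) (by omega)
    (by zify; rw [hn]; linear_combination hkZ)
    (by
      have := h.dvd_sum
      rw [← hn, hkZ] at this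
      have h1 : n ∣ (s + 1) * ((s + 1) * k) := by exact_mod_cast this
      rwa [show k * (s + 1) ^ 2 = (s + 1) * ((s + 1) * k) by ring])
    (by have := h.dvd_card; rw [← hn] at this; exact_mod_cast this)
    (by
      have h1 := h.card_mul
      zify
      rw [Nat.add_sub_cancel, h1, hn]
      linear_combination ((s : ℤ) + 1) * (s + 1) * hkZ)
    (fun p hp hpv => by have := h.prime_dvd hp hpv; rw [← hn] at this; exact_mod_cast this)
  rcases hres with ⟨h1, h2⟩ | h1
  · obtain rfl : α = k + 1 := by omega
    have h3 : s + 1 = (k + 2) * (k + 1) := h2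
    have hs : s = (k + 2) * (k + 1) - 1 := by omega
    have ht : t = k * ((k + 2) * (k + 1)) - 1 := by
      rw [h3, mul_comm] at hk; omega
    rcases (by omega : k = 1 ∨ k = 2 ∨ 3 ≤ k) with rfl | rfl | hk3
    · left; omega
    · right; left; omega
    · exfalso
      subst hs ht
      rcases Nat.eq_two_pow_or_exists_odd_prime_and_dvd k with ⟨i, rfl⟩ | ⟨p, hp, hpk, hodd⟩
      · refine false_of_two_pow ?_ ?_ h
        · by_contra hlt
          interval_cases i <;> omega
        · have : 2 ^ i < 2 ^ 10 := by omega
          have := (Nat.pow_lt_pow_iff_right (by norm_num : 1 < 2)).1 this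
          omega
      · exact false_of_odd_prime_dvd hp (by rintro rfl; exact absurd hodd (by decide)) hpk
          (by omega) h
  · have := parameters_of_mem_sporadic rfl (by rw [hk, mul_comm]) h1 h
    tauto

end IsCollinearityFunction

/-! ### Lines of a `pg(5, 5, 2)` as subsets of the Singer group -/

/-- The combinatorial properties of a line through `0` of a `pg(5, 5, 2)` of rigid type, as a subset
of its Singer group: it is a Sidon set of six elements; a point `x` outside the line lies on two
lines `x - l₁ + Λ` meeting `Λ`; and the set of differences is closed under doubling. -/
structure IsSingerLine {A : Type*} [AddCommGroup A] (Λ : Finset A) : Prop where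
  card_eq : Λ.card = 6
  zero_mem : 0 ∈ Λ
  sidon : ∀ a ∈ Λ, ∀ b ∈ Λ, ∀ c ∈ Λ, ∀ d ∈ Λ, a ≠ b → a - b = c - d → a = c
  two_lines : ∀ x, x ∉ Λ → Set.ncard {l₁ | l₁ ∈ Λ ∧ ∃ l₂ ∈ Λ, ∃ l₃ ∈ Λ, x + l₂ = l₁ + l₃} = 2
  double : ∀ a ∈ Λ, ∀ b ∈ Λ, ∃ c ∈ Λ, ∃ d ∈ Λ, (2 : ℕ) • (a - b) = c - d

namespace IsSingerLine

variable {A : Type*} [AddCommGroup A] {Λ : Finset A}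

theorem add_sub_notMem (h : IsSingerLine Λ) {a b c : A} (ha : a ∈ Λ) (hb : b ∈ Λ) (hc : c ∈ Λ)
    (hac : a ≠ c) (hbc : b ≠ c) : a + b - c ∉ Λ := by
  intro hx
  have h1 := h.sidon a ha c hc (a + b - c) hx b hb hac (by abel)
  apply hbc
  have h2 : a + b = a + c := by nth_rewrite 2 [h1]; abel
  exact add_left_cancel h2

/-- Three distinct points of `Λ` are not the first terms of expressions `l₁ + l₃ - l₂` of the same
point outside `Λ`. -/
theorem false_of_three (h : IsSingerLine Λ) {x a b c : A} (hx : x ∉ Λ) (hab : a ≠ b) (hac : a ≠ c)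
    (hbc : b ≠ c) (ha : a ∈ Λ ∧ ∃ l₂ ∈ Λ, ∃ l₃ ∈ Λ, x + l₂ = a + l₃)
    (hb : b ∈ Λ ∧ ∃ l₂ ∈ Λ, ∃ l₃ ∈ Λ, x + l₂ = b + l₃)
    (hc : c ∈ Λ ∧ ∃ l₂ ∈ Λ, ∃ l₃ ∈ Λ, x + l₂ = c + l₃) : False := by
  have hfin : Set.Finite {l₁ | l₁ ∈ Λ ∧ ∃ l₂ ∈ Λ, ∃ l₃ ∈ Λ, x + l₂ = l₁ + l₃} :=
    Λ.finite_toSet.subset fun l hl => hl.1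
  have h1 : ({a, b, c} : Set A).ncard ≤ 2 := by
    rw [← h.two_lines x hx]
    refine Set.ncard_le_ncard ?_ hfin
    rintro y (rfl | rfl | rfl) <;> assumption
  rw [Set.ncard_eq_three.2 ⟨a, b, c, hab, hac, hbc, rfl⟩] at h1
  omega

theorem eq_top_of_subset (h : IsSingerLine Λ) {H : AddSubgroup A} (hH : ∀ l ∈ Λ, l ∈ H) :
    H = ⊤ := by
  rw [eq_top_iff]
  intro x _
  by_cases hx : x ∈ Λ
  · exact hH x hx
  · obtain ⟨l₁, hl₁, l₂, hl₂, l₃, hl₃, heq⟩ :=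
      Set.nonempty_of_ncard_ne_zero (by rw [h.two_lines x hx]; norm_num)
    rw [← add_sub_cancel_right x l₂, heq]
    exact H.sub_mem (H.add_mem (hH _ hl₁) (hH _ hl₃)) (hH _ hl₂)

open Finset in
/-- The number of expressions `x = l₁ + l₂ - l₃` is `2` outside `Λ` and `11` on `Λ`. -/
theorem card_representations (h : IsSingerLine Λ) [DecidableEq A] (x : A) :
    ((#{p ∈ Λ ×ˢ Λ ×ˢ Λ | p.1 + p.2.1 - p.2.2 = x} : ℕ) : ZMod 3) = 2 := by
  by_cases hx : x ∈ Λ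
  · have h1 : {p ∈ Λ ×ˢ Λ ×ˢ Λ | p.1 + p.2.1 - p.2.2 = x}
        = Λ.image (fun l => (x, l, l)) ∪ (Λ.erase x).image (fun l => (l, x, l)) := by
      ext ⟨a, b, c⟩
      simp only [mem_filter, mem_product, mem_union, mem_image, Prod.mk.injEq, mem_erase]
      constructor
      · rintro ⟨⟨ha, hb, hc⟩, heq⟩
        by_cases hac : a = c
        · subst hac
          have hbx : b = x := by rw [← heq]; abel
          subst hbx
          by_cases hab : a = b
          · subst hab; exact Or.inl ⟨a, ha, rfl, rfl, rfl⟩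
          · exact Or.inr ⟨a, ⟨hab, ha⟩, rfl, rfl, rfl⟩
        · by_cases hbc : b = c
          · subst hbc
            have hax : a = x := by rw [← heq]; abel
            exact Or.inl ⟨b, hb, hax.symm, rfl, rfl⟩
          · exact absurd (heq ▸ hx) (h.add_sub_notMem ha hb hc hac hbc)
      · rintro (⟨l, hl, rfl, rfl, rfl⟩ | ⟨l, ⟨-, hl⟩, rfl, rfl, rfl⟩)
        · exact ⟨⟨hx, hl, hl⟩, by abel⟩
        · exact ⟨⟨hl, hx, hl⟩, by abel⟩
    rw [h1, card_union_of_disjoint, card_image_of_injective, card_image_of_injective,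
      card_erase_of_mem hx, h.card_eq]
    · decide
    · intro a b hab; exact (Prod.mk.inj hab).1
    · intro a b hab; exact (Prod.mk.inj (Prod.mk.inj hab).2).1
    · rw [disjoint_left]
      intro p hp hp'
      obtain ⟨l, hl, rfl⟩ := mem_image.1 hp
      obtain ⟨m, hm, hm'⟩ := mem_image.1 hp'
      simp only [Prod.mk.injEq] at hm'
      exact (mem_erase.1 hm).1 hm'.1
  · have h1 : #{p ∈ Λ ×ˢ Λ ×ˢ Λ | p.1 + p.2.1 - p.2.2 = x} = 2 := by
      rw [← h.two_lines x hx, ← card_image_of_injOn (f := Prod.fst), ← Set.ncard_coe_finset]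
      · congr 1
        ext l
        simp only [coe_image, Set.mem_image, mem_coe, mem_filter, mem_product, Set.mem_ofPred_eq,
          Prod.exists, exists_and_right, exists_eq_right]
        constructor
        · rintro ⟨b, c, ⟨hl, hb, hc⟩, heq⟩
          exact ⟨hl, c, hc, b, hb, by rw [← heq]; abel⟩
        · rintro ⟨hl, c, hc, b, hb, heq⟩
          exact ⟨b, c, ⟨hl, hb, hc⟩, by rw [← heq]; abel⟩
      · rintro ⟨a, b, c⟩ hp ⟨a', b', c'⟩ hp' haa
        simp only [mem_coe, mem_filter, mem_product] at hp hp' haa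
        subst haa
        obtain ⟨⟨ha, hb, hc⟩, heq⟩ := hp
        obtain ⟨⟨-, hb', hc'⟩, heq'⟩ := hp'
        have hbc : b ≠ c := by
          rintro rfl
          exact hx (by rw [← heq, add_sub_cancel_right]; exact ha)
        have h2 : b - c = b' - c' := by
          rw [add_sub_assoc] at heq heq'
          exact add_left_cancel (heq.trans heq'.symm)
        have h3 := h.sidon b hb c hc b' hb' c' hc' hbc h2
        subst h3
        rw [sub_right_inj.1 h2]
    rw [h1]; rfl

open AddMonoidAlgebra in
/-- In the group ring over the field with three elements, where subsets stand for the sums of their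
elements, `Λ² Λ⁻¹ = 2 A` and hence `Λ³ Λ⁻¹ = 0`. As `Λ³` is the image of `Λ` under multiplication by
three, this equation splits into one equation for each coset of `3A`, and if `T` is a union of
cosets then `Λ³ (Λ ∩ T)⁻¹ = 0`. The `81`-st power of `Λ ∩ T` is its order. If that is prime to
three, then `Λ ∩ T` is a unit and `Λ³` vanishes. -/
theorem card_filter_dvd (h : IsSingerLine Λ) [Fintype A] [DecidableEq A]
    (hA : Fintype.card A = 81) (T : A → Prop) [DecidablePred T]
    (hT : ∀ x y, T (x + (3 : ℕ) • y) ↔ T x) (hTΛ : ¬ 3 ∣ (Λ.filter T).card) (y : A) :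
    3 ∣ (Λ.filter fun l => (3 : ℕ) • l = y).card := by
  have : Fact (Nat.Prime 3) := ⟨Nat.prime_three⟩
  have : CharP (AddMonoidAlgebra (ZMod 3) A) 3 :=
    charP_of_injective_algebraMap (algebraMap (ZMod 3) _).injective 3
  set E : AddMonoidAlgebra (ZMod 3) A := ∑ l ∈ Λ, single l 1 with hE
  set E' : AddMonoidAlgebra (ZMod 3) A := ∑ l ∈ Λ, single (-l) 1 with hE'
  set M : AddMonoidAlgebra (ZMod 3) A := ∑ l ∈ Λ, single ((3 : ℕ) • l) 1 with hM
  set F : AddMonoidAlgebra (ZMod 3) A := ∑ l ∈ Λ.filter T, single (-l) 1 with hF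
  have hE3 : E ^ 3 = M := by
    rw [hE, sum_pow_char 3]
    simp [single_pow, hM]
  have hEEE : E * E * E' = groupRingOf fun _ : A => (2 : ZMod 3) := by
    ext x
    rw [coeff_groupRingOf, ← h.card_representations x, hE, hE', Finset.sum_mul_sum,
      Finset.sum_mul]
    simp only [Finset.sum_mul, Finset.mul_sum, single_mul_single, mul_one]
    rw [Finset.card_filter, Finset.sum_product]
    simp only [Finset.sum_product]
    simp only [coeff_sum, coeff_single, Finsupp.finsetSum_apply, Finsupp.single_apply,
      ← sub_eq_add_neg, Nat.cast_sum, Nat.cast_ite, Nat.cast_one, Nat.cast_zero]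
    exact Finset.sum_congr rfl fun a _ => Finset.sum_comm
  have hME : M * E' = 0 := by
    have h1 : E * groupRingOf (fun _ : A => (2 : ZMod 3)) = 0 := by
      rw [hE, Finset.sum_mul]
      have : ∀ l, single l (1 : ZMod 3) * groupRingOf (fun _ : A => (2 : ZMod 3))
          = groupRingOf fun _ => 2 := by
        intro l
        rw [groupRingOf, Finset.mul_sum]
        simp only [single_mul_single, one_mul]
        exact Fintype.sum_equiv (Equiv.addLeft l) _ _ fun a => rfl
      simp_rw [this]
      rw [Finset.sum_const, h.card_eq]
      have h6 : ((6 : ℕ) : AddMonoidAlgebra (ZMod 3) A) = 0 :=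
        (CharP.cast_eq_zero_iff _ 3 6).2 (by norm_num)
      rw [nsmul_eq_mul, h6, zero_mul]
    rw [← hE3, pow_succ', pow_two, mul_assoc, hEEE, h1]
  have hcoeff : ∀ (s : Finset A) (x : A), (M * ∑ l ∈ s, single (-l) 1).coeff x
      = ∑ l ∈ Λ, ∑ m ∈ s, if (3 : ℕ) • l - m = x then (1 : ZMod 3) else 0 := by
    intro s x
    rw [hM, Finset.sum_mul_sum]
    simp [single_mul_single, Finsupp.finsetSum_apply, Finsupp.single_apply, sub_eq_add_neg]
  have hMF : M * F = 0 := by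
    ext x
    rw [hF, hcoeff]
    by_cases hx : T (-x)
    · have h1 := congrArg (fun z => z.coeff x) hME
      simp only [hE', hcoeff] at h1
      refine Eq.trans ?_ h1
      refine Finset.sum_congr rfl fun l _ => ?_
      refine Finset.sum_filter_of_ne fun m _ hm => ?_
      have h2 : (3 : ℕ) • l - m = x := by
        by_contra h3
        exact hm (if_neg h3)
      rw [← h2, neg_sub, sub_eq_add_neg, ← smul_neg, hT] at hx
      exact hx
    · refine Finset.sum_eq_zero fun l _ => Finset.sum_eq_zero fun m hm => if_neg fun h2 => hx ?_
      rw [← h2, neg_sub, sub_eq_add_neg, ← smul_neg, hT]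
      exact (Finset.mem_filter.1 hm).2
  have hF81 : F ^ 3 ^ 4 = ((Λ.filter T).card : AddMonoidAlgebra (ZMod 3) A) := by
    rw [hF, sum_pow_char_pow 3]
    have : ∀ l : A, (3 ^ 4 : ℕ) • (-l) = 0 := fun l => by
      rw [show (3 ^ 4 : ℕ) = Fintype.card A by rw [hA]; rfl, card_nsmul_eq_zero]
    simp only [single_pow, this, one_pow]
    rw [Finset.sum_const, nsmul_eq_mul]
    exact mul_one _
  have hM0 : M = 0 := by
    have h1 : M * F ^ 3 ^ 4 = 0 := by
      rw [show 3 ^ 4 = 80 + 1 by norm_num, pow_succ', ← mul_assoc, hMF, zero_mul]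
    rw [hF81] at h1
    have h2 : IsUnit ((Λ.filter T).card : AddMonoidAlgebra (ZMod 3) A) := by
      have h3 : ((Λ.filter T).card : ZMod 3) ≠ 0 := by rwa [Ne, ZMod.natCast_eq_zero_iff]
      have := (isUnit_iff_ne_zero.2 h3).map (algebraMap (ZMod 3) (AddMonoidAlgebra (ZMod 3) A))
      rwa [map_natCast] at this
    exact (h2.mul_left_eq_zero).1 h1
  have h1 := congrArg (fun z => z.coeff y) hM0
  rw [← ZMod.natCast_eq_zero_iff, ← Finset.sum_boole]
  simpa [hM, Finsupp.finsetSum_apply, Finsupp.single_apply] using h1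

end IsSingerLine

/-! ### The Singer group has exponent three -/

namespace IsSingerLine

variable {A : Type*} [AddCommGroup A] {Λ : Finset A}

theorem exists_two_pow_nsmul_eq (h : IsSingerLine Λ) {b : A} (hb : b ∈ Λ) (i : ℕ) :
    ∃ c ∈ Λ, ∃ d ∈ Λ, (2 ^ i : ℕ) • b = c - d := by
  induction i with
  | zero => exact ⟨b, hb, 0, h.zero_mem, by simp⟩
  | succ i ih =>
    obtain ⟨c, hc, d, hd, heq⟩ := ih
    rw [pow_succ', mul_smul, heq]
    exact h.double c hc d hd

theorem two_nsmul_injective [Fintype A] (hA : Fintype.card A = 81) {x : A}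
    (hx : (2 : ℕ) • x = 0) : x = 0 := by
  have h1 : (81 : ℕ) • x = 0 := by rw [← hA, card_nsmul_eq_zero]
  rw [show 81 = 40 * 2 + 1 by norm_num, succ_nsmul, mul_smul, hx] at h1
  simpa using h1

/-- If all cosets of `3A` met `Λ` in a multiple of three points, then `Λ` would be contained in two
of them, `A` would be cyclic, and the `30` differences of `Λ` could not be closed under doubling. -/
theorem exists_coset (h : IsSingerLine Λ) [Fintype A] (hA : Fintype.card A = 81)
    [∀ b : A, DecidablePred fun l => ∃ y : A, l = b + (3 : ℕ) • y] :
    ∃ b : A, ¬ 3 ∣ (Λ.filter fun l => ∃ y, l = b + (3 : ℕ) • y).card := by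
  classical
  by_contra! hall
  have hpos : ∀ b ∈ Λ, 3 ≤ (Λ.filter fun l => ∃ y, l = b + (3 : ℕ) • y).card := fun b hb =>
    Nat.le_of_dvd (Finset.card_pos.2 ⟨b, Finset.mem_filter.2 ⟨hb, 0, by simp⟩⟩) (hall b)
  set N : AddSubgroup A := (nsmulAddMonoidHom (α := A) 3).range with hN
  have hmemN : ∀ x, x ∈ N ↔ ∃ y, (3 : ℕ) • y = x := fun x => by simp [hN, AddMonoidHom.mem_range]
  obtain ⟨b, hb, hbN⟩ : ∃ b ∈ Λ, b ∉ N := by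
    by_contra! hsub
    have hsurj : Function.Surjective fun x : A => (3 : ℕ) • x := fun y =>
      (hmemN y).1 (by rw [h.eq_top_of_subset hsub]; trivial)
    have : Fact (Nat.Prime 3) := ⟨Nat.prime_three⟩
    obtain ⟨x, hx⟩ := exists_prime_addOrderOf_dvd_card (G := A) 3 (by rw [hA]; norm_num)
    have h1 : x = 0 := Finite.injective_iff_surjective.2 hsurj (by
      show (3 : ℕ) • x = (3 : ℕ) • 0
      rw [smul_zero, ← hx, addOrderOf_nsmul_eq_zero])
    rw [h1, addOrderOf_zero] at hx
    norm_num at hx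
  have hdisj : Disjoint (Λ.filter fun l => ∃ y, l = 0 + (3 : ℕ) • y)
      (Λ.filter fun l => ∃ y, l = b + (3 : ℕ) • y) := by
    rw [Finset.disjoint_left]
    intro l hl hl'
    obtain ⟨y, hy⟩ := (Finset.mem_filter.1 hl).2
    obtain ⟨z, hz⟩ := (Finset.mem_filter.1 hl').2
    refine hbN ((hmemN b).2 ⟨y - z, ?_⟩)
    rw [smul_sub, ← zero_add ((3 : ℕ) • y), ← hy, hz]; abel
  have hunion : (Λ.filter fun l => ∃ y, l = 0 + (3 : ℕ) • y) ∪
      (Λ.filter fun l => ∃ y, l = b + (3 : ℕ) • y) = Λ := by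
    refine Finset.eq_of_subset_of_card_le
      (Finset.union_subset (Finset.filter_subset _ _) (Finset.filter_subset _ _)) ?_
    rw [Finset.card_union_of_disjoint hdisj, h.card_eq]
    have h1 := hpos 0 h.zero_mem
    have h2 := hpos b hb
    omega
  have htop : AddSubgroup.zmultiples b ⊔ N = ⊤ := by
    refine h.eq_top_of_subset fun l hl => ?_
    rw [← hunion, Finset.mem_union, Finset.mem_filter, Finset.mem_filter] at hl
    rcases hl with ⟨-, y, rfl⟩ | ⟨-, y, rfl⟩
    · rw [zero_add]
      exact AddSubgroup.mem_sup_right ((hmemN _).2 ⟨y, rfl⟩)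
    · exact AddSubgroup.add_mem_sup (AddSubgroup.mem_zmultiples b) ((hmemN _).2 ⟨y, rfl⟩)
  have hstep : ∀ x : A, ∃ k : ℤ, ∃ y : A, x = k • b + (3 : ℕ) • y := by
    intro x
    have hx : x ∈ AddSubgroup.zmultiples b ⊔ N := by rw [htop]; trivial
    obtain ⟨u, hu, v, hv, rfl⟩ := AddSubgroup.mem_sup.1 hx
    obtain ⟨k, rfl⟩ := AddSubgroup.mem_zmultiples_iff.1 hu
    obtain ⟨y, rfl⟩ := (hmemN v).1 hv
    exact ⟨k, y, rfl⟩
  have hiter : ∀ m : ℕ, ∀ x : A, ∃ k : ℤ, ∃ y : A, x = k • b + (3 ^ m : ℕ) • y := by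
    intro m
    induction m with
    | zero => exact fun x => ⟨0, x, by simp⟩
    | succ m ih =>
      intro x
      obtain ⟨k, y, rfl⟩ := ih x
      obtain ⟨k', y', rfl⟩ := hstep y
      refine ⟨k + 3 ^ m * k', y', ?_⟩
      rw [smul_add, ← add_assoc, ← mul_smul, ← pow_succ, add_smul, mul_smul]
      congr 2
      rw [← natCast_zsmul]
      push_cast; rfl
  have hgen : ∀ x : A, x ∈ AddSubgroup.zmultiples b := by
    intro x
    obtain ⟨k, y, rfl⟩ := hiter 4 x
    rw [show (3 ^ 4 : ℕ) = Fintype.card A by rw [hA]; rfl, card_nsmul_eq_zero, add_zero]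
    exact AddSubgroup.zsmul_mem_zmultiples b k
  have hord : addOrderOf b = 81 := by
    rw [addOrderOf_eq_card_of_forall_mem_zmultiples hgen, Nat.card_eq_fintype_card, hA]
  -- the `31` elements `2 ^ i • b` are distinct, but they are among the `30` differences of `Λ`
  obtain ⟨i, hi, j, hj, hij, heq⟩ := Finset.exists_ne_map_eq_of_card_lt_of_maps_to
    (s := Finset.range 31) (t := Λ.offDiag.image fun p => p.1 - p.2)
    (f := fun i => (2 ^ i : ℕ) • b)
    (by
      refine lt_of_le_of_lt Finset.card_image_le ?_
      rw [Finset.offDiag_card, h.card_eq]; decide)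
    (by
      intro i _
      obtain ⟨c, hc, d, hd, heq⟩ := h.exists_two_pow_nsmul_eq hb i
      refine Finset.mem_coe.2 (Finset.mem_image.2 ⟨(c, d), ?_, heq.symm⟩)
      rw [Finset.mem_offDiag]
      refine ⟨hc, hd, ?_⟩
      intro (hcd : c = d)
      rw [hcd, sub_self, ← addOrderOf_dvd_iff_nsmul_eq_zero, hord] at heq
      have : 3 ∣ 2 := Nat.prime_three.dvd_of_dvd_pow (Dvd.dvd.trans (by norm_num) heq)
      norm_num at this)
  have h1 := (nsmul_eq_nsmul_iff_modEq (x := b)).1 heq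
  rw [hord] at h1
  have h2 : ∀ i < 31, ∀ j < 31, 2 ^ i % 81 = 2 ^ j % 81 → i = j := by decide +kernel
  exact hij (h2 i (Finset.mem_range.1 hi) j (Finset.mem_range.1 hj) h1)

theorem card_filter_three_nsmul_dvd (h : IsSingerLine Λ) [Fintype A] [DecidableEq A]
    (hA : Fintype.card A = 81) (y : A) : 3 ∣ (Λ.filter fun l => (3 : ℕ) • l = y).card := by
  classical
  obtain ⟨b, hb⟩ := h.exists_coset hA
  refine h.card_filter_dvd hA _ ?_ hb y
  intro x z
  constructor
  · rintro ⟨w, hw⟩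
    exact ⟨w - z, by rw [smul_sub, ← add_sub_assoc, ← hw]; abel⟩
  · rintro ⟨w, rfl⟩
    exact ⟨w + z, by rw [smul_add]; abel⟩

/-- No three points of `Λ` are in arithmetic progression. -/
theorem eq_of_add_eq (h : IsSingerLine Λ) {a b c : A} (ha : a ∈ Λ) (hb : b ∈ Λ) (hc : c ∈ Λ)
    (habc : a - b = b - c) : a = b := by
  by_contra hab
  exact hab (h.sidon a ha b hb b hb c hc hab habc)

theorem eq_of_sum_eq_three_nsmul (h : IsSingerLine Λ) {a b c : A} (ha : a ∈ Λ) (hb : b ∈ Λ)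
    (hc : c ∈ Λ) (habc : a + b + c = (3 : ℕ) • b) : a = b ∧ c = b := by
  have h1 : a - b = b - c := by
    rw [sub_eq_sub_iff_add_eq_add]
    have : a + c + b = b + b + b := by
      rw [show a + c + b = a + b + c by abel, habc]; abel
    exact add_right_cancel this
  have h2 := h.eq_of_add_eq ha hb hc h1
  refine ⟨h2, ?_⟩
  rw [h2, sub_self] at h1
  exact (sub_eq_zero.1 h1.symm).symm

theorem eq_of_sum_eq_three_nsmul' (h : IsSingerLine Λ) {ι : Type*} {S : Finset ι} (hS : S.card = 3)
    {f : ι → A} (hf : ∀ i ∈ S, f i ∈ Λ) (hsum : ∀ i ∈ S, ∑ j ∈ S, f j = (3 : ℕ) • f i) {i j : ι}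
    (hi : i ∈ S) (hj : j ∈ S) : f i = f j := by
  classical
  obtain ⟨a, b, c, hab, hac, hbc, rfl⟩ := Finset.card_eq_three.1 hS
  have h1 := hsum b (by simp)
  rw [Finset.sum_insert (by simp [hab, hac]), Finset.sum_pair hbc, ← add_assoc] at h1
  obtain ⟨h2, h3⟩ := h.eq_of_sum_eq_three_nsmul (hf a (by simp)) (hf b (by simp))
    (hf c (by simp)) h1
  have h4 : ∀ k ∈ ({a, b, c} : Finset ι), f k = f b := by
    intro k hk
    simp only [Finset.mem_insert, Finset.mem_singleton] at hk
    rcases hk with rfl | rfl | rfl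
    · exact h2
    · rfl
    · exact h3
  rw [h4 i hi, h4 j hj]

/-- Otherwise, `Λ` consists of three points `a` with `3a = 0` and three points `b` with
`3b = t ≠ 0`. Doubling the differences `b - a` gives equations `2(b - a) = α(a, b) - β(a, b)`.
Summing these over one of the variables shows that `α` depends only on `a` and `β` only on `b`, and
then `Λ` contains an arithmetic progression. -/
theorem three_nsmul_eq_zero (h : IsSingerLine Λ) [Fintype A] (hA : Fintype.card A = 81) (x : A) :
    (3 : ℕ) • x = 0 := by
  classical
  suffices hl : ∀ l ∈ Λ, (3 : ℕ) • l = 0 by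
    have htop := h.eq_top_of_subset (H := (nsmulAddMonoidHom (α := A) 3).ker)
      fun l hlΛ => AddMonoidHom.mem_ker.2 (hl l hlΛ)
    have : x ∈ (nsmulAddMonoidHom (α := A) 3).ker := by rw [htop]; trivial
    exact AddMonoidHom.mem_ker.1 this
  by_contra! hne
  obtain ⟨b₀, hb₀, hb₀3⟩ := hne
  obtain ⟨t, ht⟩ : ∃ t, t = (3 : ℕ) • b₀ := ⟨_, rfl⟩
  have ht0 : t ≠ 0 := ht ▸ hb₀3
  set S := Λ.filter fun l => (3 : ℕ) • l = 0 with hS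
  set B := Λ.filter fun l => (3 : ℕ) • l = t with hB
  have hmemS : ∀ l, l ∈ S ↔ l ∈ Λ ∧ (3 : ℕ) • l = 0 := fun l => Finset.mem_filter
  have hmemB : ∀ l, l ∈ B ↔ l ∈ Λ ∧ (3 : ℕ) • l = t := fun l => Finset.mem_filter
  have h0S : 0 ∈ S := (hmemS 0).2 ⟨h.zero_mem, smul_zero _⟩
  have hb₀B : b₀ ∈ B := (hmemB b₀).2 ⟨hb₀, ht.symm⟩
  have hdisj : Disjoint S B := by
    rw [Finset.disjoint_left]
    intro l hl hl'
    exact ht0 (((hmemB l).1 hl').2.symm.trans ((hmemS l).1 hl).2)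
  have hSdvd : 3 ∣ S.card := h.card_filter_three_nsmul_dvd hA 0
  have hBdvd : 3 ∣ B.card := h.card_filter_three_nsmul_dvd hA t
  have hSpos : 0 < S.card := Finset.card_pos.2 ⟨0, h0S⟩
  have hBpos : 0 < B.card := Finset.card_pos.2 ⟨b₀, hb₀B⟩
  have hsub : S ∪ B ⊆ Λ := Finset.union_subset (Finset.filter_subset _ _) (Finset.filter_subset _ _)
  have hcard : S.card + B.card ≤ 6 := by
    rw [← Finset.card_union_of_disjoint hdisj, ← h.card_eq]
    exact Finset.card_le_card hsub
  have hS3 : S.card = 3 := by omega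
  have hB3 : B.card = 3 := by omega
  have hunion : S ∪ B = Λ := Finset.eq_of_subset_of_card_le hsub (by
    rw [Finset.card_union_of_disjoint hdisj, h.card_eq]; omega)
  have hcl : ∀ l ∈ Λ, (3 : ℕ) • l = 0 ∨ (3 : ℕ) • l = t := by
    intro l hl
    rw [← hunion, Finset.mem_union] at hl
    exact hl.imp (fun h' => ((hmemS l).1 h').2) (fun h' => ((hmemB l).1 h').2)
  have h2t : (2 : ℕ) • t ≠ 0 := fun h' => ht0 (two_nsmul_injective hA h')
  have hdouble : ∀ a ∈ S, ∀ b ∈ B, ∃ c ∈ S, ∃ d ∈ B, (2 : ℕ) • (b - a) = c - d := by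
    intro a ha b hb
    obtain ⟨ha1, ha3⟩ := (hmemS a).1 ha
    obtain ⟨hb1, hb3⟩ := (hmemB b).1 hb
    obtain ⟨c, hc, d, hd, heq⟩ := h.double b hb1 a ha1
    have h3 : (2 : ℕ) • t = (3 : ℕ) • c - (3 : ℕ) • d := by
      rw [← smul_sub, ← heq, smul_comm, smul_sub 3 b a, ha3, hb3, sub_zero]
    rcases hcl c hc with hc3 | hc3 <;> rcases hcl d hd with hd3 | hd3 <;> rw [hc3, hd3] at h3
    · rw [sub_self] at h3; exact absurd h3 h2t
    · exact ⟨c, (hmemS c).2 ⟨hc, hc3⟩, d, (hmemB d).2 ⟨hd, hd3⟩, heq⟩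
    · rw [two_nsmul, sub_zero] at h3
      exact absurd (left_eq_add.1 h3.symm) ht0
    · rw [sub_self] at h3; exact absurd h3 h2t
  have h3t : (3 : ℕ) • t = 0 := by
    obtain ⟨c, hc, d, hd, heq⟩ := hdouble 0 h0S b₀ hb₀B
    have h3 : (2 : ℕ) • t = (3 : ℕ) • c - (3 : ℕ) • d := by
      rw [← smul_sub, ← heq, smul_comm, sub_zero, ← ht]
    rw [((hmemS c).1 hc).2, ((hmemB d).1 hd).2, zero_sub] at h3
    rw [succ_nsmul, h3, neg_add_cancel]
  choose! α hα β' hβ hαβ using hdouble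
  obtain ⟨β, hβα⟩ : ∃ β : A → A → A, ∀ a ∈ S, ∀ b ∈ B, β a b ∈ B ∧
      b + b + β a b = a + a + α a b := by
    refine ⟨β', fun a ha b hb => ⟨hβ a ha b hb, ?_⟩⟩
    have := hαβ a ha b hb
    rw [two_nsmul] at this
    calc b + b + β' a b = (b - a + (b - a)) + a + a + β' a b := by abel
      _ = a + a + α a b := by rw [this]; abel
  have hSΛ : ∀ a ∈ S, a ∈ Λ := fun a ha => ((hmemS a).1 ha).1
  have hBΛ : ∀ b ∈ B, b ∈ Λ := fun b hb => ((hmemB b).1 hb).1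
  have hSB : ∀ a ∈ S, ∀ b ∈ B, a ≠ b := fun a ha b hb => Finset.disjoint_iff_ne.1 hdisj a ha b hb
  -- the two lines through `a + a - β a b` meeting `Λ` are those for the first terms `a` and `b`
  have hβinj : ∀ a ∈ S, Set.InjOn (β a) B := by
    intro a ha b hb b' hb' hbb
    by_contra hne
    have hd := (hβα a ha b hb).1
    refine h.false_of_three (h.add_sub_notMem (hSΛ a ha) (hSΛ a ha) (hBΛ _ hd) (hSB a ha _ hd)
      (hSB a ha _ hd)) (hSB a ha b hb) (hSB a ha b' hb') hne
      ⟨hSΛ a ha, β a b, hBΛ _ hd, a, hSΛ a ha, sub_add_cancel _ _⟩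
      ⟨hBΛ b hb, α a b, hSΛ _ (hα a ha b hb), b, hBΛ b hb, ?_⟩
      ⟨hBΛ b' hb', α a b', hSΛ _ (hα a ha b' hb'), b', hBΛ b' hb', ?_⟩
    · rw [sub_add_eq_add_sub, ← (hβα a ha b hb).2, add_sub_cancel_right]
    · rw [hbb, sub_add_eq_add_sub, ← (hβα a ha b' hb').2, add_sub_cancel_right]
  have hαinj : ∀ b ∈ B, Set.InjOn (fun a => α a b) S := by
    intro b hb a ha a' ha' haa
    by_contra hne
    have hc := hα a ha b hb
    refine h.false_of_three (h.add_sub_notMem (hBΛ b hb) (hBΛ b hb) (hSΛ _ hc) (hSB _ hc b hb).symm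
      (hSB _ hc b hb).symm) (hSB a ha b hb).symm (hSB a' ha' b hb).symm hne
      ⟨hBΛ b hb, α a b, hSΛ _ hc, b, hBΛ b hb, sub_add_cancel _ _⟩
      ⟨hSΛ a ha, β a b, hBΛ _ (hβα a ha b hb).1, a, hSΛ a ha, ?_⟩
      ⟨hSΛ a' ha', β a' b, hBΛ _ (hβα a' ha' b hb).1, a', hSΛ a' ha', ?_⟩
    · rw [sub_add_eq_add_sub, (hβα a ha b hb).2, add_sub_cancel_right]
    · rw [show α a b = α a' b from haa, sub_add_eq_add_sub, (hβα a' ha' b hb).2,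
        add_sub_cancel_right]
  have hperm : ∀ (U : Finset A) (f : A → A), (∀ u ∈ U, f u ∈ U) → Set.InjOn f U →
      ∑ u ∈ U, f u = ∑ u ∈ U, u := by
    intro U f hf hinj
    exact Finset.sum_nbij f hf hinj (Finset.surjOn_of_injOn_of_card_le f hf hinj le_rfl)
      fun _ _ => rfl
  have hB3t : ∀ b ∈ B, b + b + b = t := fun b hb => by rw [← ((hmemB b).1 hb).2]; abel
  have hS30 : ∀ a ∈ S, a + a + a = 0 := fun a ha => by rw [← ((hmemS a).1 ha).2]; abel
  -- `α a` maps `B` to points with sum `3 (α a b) = 0`, so that it is constant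
  have hαconst : ∀ a ∈ S, ∀ b ∈ B, α a b = α a b₀ := by
    intro a ha b hb
    refine h.eq_of_sum_eq_three_nsmul' hB3 (f := α a) (fun b hb => hSΛ _ (hα a ha b hb)) ?_ hb hb₀B
    intro b hb
    rw [((hmemS _).1 (hα a ha b hb)).2]
    have h1 : ∑ b ∈ B, (b + b + β a b) = ∑ b ∈ B, (a + a + α a b) :=
      Finset.sum_congr rfl fun b hb => (hβα a ha b hb).2
    rw [Finset.sum_add_distrib, hperm B (β a) (fun b hb => (hβα a ha b hb).1) (hβinj a ha),
      ← Finset.sum_add_distrib, Finset.sum_add_distrib (f := fun _ => a + a), Finset.sum_const, hB3,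
      smul_add, ((hmemS a).1 ha).2, add_zero, zero_add] at h1
    rw [← h1, Finset.sum_congr rfl hB3t, Finset.sum_const, hB3, h3t]
  have hβconst : ∀ b ∈ B, ∀ a ∈ S, β a b = β 0 b := by
    intro b hb a ha
    refine h.eq_of_sum_eq_three_nsmul' hS3 (f := fun a => β a b)
      (fun a ha => hBΛ _ (hβα a ha b hb).1) ?_ ha h0S
    intro a ha
    rw [((hmemB _).1 (hβα a ha b hb).1).2]
    have h1 : ∑ a ∈ S, (b + b + β a b) = ∑ a ∈ S, (a + a + α a b) :=
      Finset.sum_congr rfl fun a ha => (hβα a ha b hb).2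
    rw [Finset.sum_add_distrib (g := fun a => α a b), hperm S (fun a => α a b)
      (fun a ha => hα a ha b hb) (hαinj b hb),
      ← Finset.sum_add_distrib, Finset.sum_add_distrib (f := fun _ => b + b), Finset.sum_const, hS3,
      smul_add, ((hmemB b).1 hb).2, Finset.sum_congr rfl hS30,
      Finset.sum_const_zero] at h1
    have h2 : t + t + t = 0 := by rw [← h3t]; abel
    have h4 : ∑ a ∈ S, β a b = -(t + t) := (neg_eq_of_add_eq_zero_right h1).symm
    rw [h4]
    exact neg_eq_of_add_eq_zero_right h2
  have hκ : ∀ a ∈ S, ∀ b ∈ B, b + b + β 0 b = a + a + α a b₀ := by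
    intro a ha b hb
    rw [← hαconst a ha b hb, ← hβconst b hb a ha]
    exact (hβα a ha b hb).2
  have hκ0 : α 0 b₀ = 0 := by
    have hκS := hα 0 h0S b₀ hb₀B
    have h1 := (hκ 0 h0S b₀ hb₀B).symm.trans (hκ _ hκS b₀ hb₀B)
    rw [zero_add, zero_add] at h1
    refine h.eq_of_add_eq (hSΛ _ hκS) h.zero_mem (hSΛ _ (hα _ hκS b₀ hb₀B)) ?_
    rw [sub_zero, zero_sub, eq_neg_iff_add_eq_zero]
    have h2 : α 0 b₀ + 0 = α 0 b₀ + (α 0 b₀ + α (α 0 b₀) b₀) := by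
      rw [← add_assoc, ← h1, add_zero]
    exact (add_left_cancel h2).symm
  have hβ0 : ∀ b ∈ B, b - β 0 b = t := by
    intro b hb
    have h1 := hκ 0 h0S b hb
    rw [hκ0, add_zero, add_zero, add_eq_zero_iff_eq_neg] at h1
    rw [← ((hmemB b).1 hb).2, ← neg_neg (β 0 b), ← h1]; abel
  have hb₁ := (hβα 0 h0S b₀ hb₀B).1
  have h1 := h.eq_of_add_eq hb₀ (hBΛ _ hb₁) (hBΛ _ (hβα 0 h0S _ hb₁).1)
    ((hβ0 b₀ hb₀B).trans (hβ0 _ hb₁).symm)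
  have h2 := hβ0 b₀ hb₀B
  rw [← h1, sub_self] at h2
  exact ht0 h2.symm

end IsSingerLine

/-! ### Identification with the fifth roots of unity -/

namespace IsSingerLine

variable {A : Type*} [AddCommGroup A] {Λ : Finset A}

open Finset in
/-- Two disjoint subsets of `Λ`, not both empty, which have the same sum and whose orders are
congruent modulo `3` can only be `Λ` and the empty set. -/
theorem sum_eq_zero_of_sum_eq_sum (h : IsSingerLine Λ) (h3 : ∀ x : A, (3 : ℕ) • x = 0)
    [DecidableEq A] {U V : Finset A} (hU : U ⊆ Λ) (hV : V ⊆ Λ) (hUV : Disjoint U V)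
    (hmod : #U ≡ #V [MOD 3]) (hle : #V ≤ #U) (hne : U.Nonempty)
    (hsum : ∑ u ∈ U, u = ∑ v ∈ V, v) : ∑ l ∈ Λ, l = 0 := by
  have hcard : #U + #V ≤ 6 := by
    rw [← card_union_of_disjoint hUV, ← h.card_eq]
    exact card_le_card (union_subset hU hV)
  have hpos := hne.card_pos
  have hcases : (#U = 1 ∧ #V = 1) ∨ (#U = 2 ∧ #V = 2) ∨ (#U = 3 ∧ #V = 0) ∨ (#U = 3 ∧ #V = 3) ∨
      (#U = 4 ∧ #V = 1) ∨ (#U = 6 ∧ #V = 0) := by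
    unfold Nat.ModEq at hmod
    omega
  have htriple : ∀ x : A, x + x + x = 0 := fun x => by rw [← h3 x]; abel
  rw [disjoint_iff_ne] at hUV
  rcases hcases with ⟨hU1, hV1⟩ | ⟨hU1, hV1⟩ | ⟨hU1, hV1⟩ | ⟨hU1, hV1⟩ | ⟨hU1, hV1⟩ | ⟨hU1, hV1⟩
  · obtain ⟨u, rfl⟩ := card_eq_one.1 hU1
    obtain ⟨v, rfl⟩ := card_eq_one.1 hV1
    rw [sum_singleton, sum_singleton] at hsum
    exact absurd hsum (hUV u (by simp) v (by simp))
  · obtain ⟨u₁, u₂, hu, rfl⟩ := card_eq_two.1 hU1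
    obtain ⟨v₁, v₂, hv, rfl⟩ := card_eq_two.1 hV1
    rw [sum_pair hu, sum_pair hv] at hsum
    have hne := hUV u₁ (by simp) v₁ (by simp)
    exact absurd (h.sidon u₁ (hU (by simp)) v₁ (hV (by simp)) v₂ (hV (by simp)) u₂ (hU (by simp))
      hne (by rw [sub_eq_sub_iff_add_eq_add, hsum, add_comm])) (hUV u₁ (by simp) v₂ (by simp))
  · obtain ⟨a, b, c, hab, hac, hbc, rfl⟩ := card_eq_three.1 hU1
    rw [card_eq_zero.1 hV1, sum_empty, sum_insert (by simp [hab, hac]), sum_pair hbc,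
      ← add_assoc] at hsum
    exact absurd (h.eq_of_sum_eq_three_nsmul (hU (by simp)) (hU (by simp)) (hU (by simp))
      (hsum.trans (h3 b).symm)).1 hab
  · obtain ⟨u₁, u₂, u₃, hu12, hu13, hu23, rfl⟩ := card_eq_three.1 hU1
    obtain ⟨v₁, v₂, v₃, hv12, hv13, hv23, rfl⟩ := card_eq_three.1 hV1
    rw [sum_insert (by simp [hu12, hu13]), sum_pair hu23, sum_insert (by simp [hv12, hv13]),
      sum_pair hv23] at hsum
    have hx := h.add_sub_notMem (hU (by simp : u₁ ∈ _)) (hU (by simp : u₂ ∈ _))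
      (hV (by simp : v₁ ∈ _)) (hUV _ (by simp) _ (by simp)) (hUV _ (by simp) _ (by simp))
    refine (h.false_of_three hx hu12 (hUV u₁ (by simp) v₂ (by simp)) (hUV u₂ (by simp) v₂ (by simp))
      ⟨hU (by simp), v₁, hV (by simp), u₂, hU (by simp), by abel⟩
      ⟨hU (by simp), v₁, hV (by simp), u₁, hU (by simp), by abel⟩
      ⟨hV (by simp), u₃, hU (by simp), v₃, hV (by simp), ?_⟩).elim
    calc u₁ + u₂ - v₁ + u₃ = u₁ + (u₂ + u₃) - v₁ := by abel
      _ = v₂ + v₃ := by rw [hsum]; abel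
  · obtain ⟨v, rfl⟩ := card_eq_one.1 hV1
    obtain ⟨u₁, hu₁⟩ := hne
    obtain ⟨u₂, u₃, u₄, hu23, hu24, hu34, hE⟩ := card_eq_three.1
      (show #(U.erase u₁) = 3 by rw [card_erase_of_mem hu₁, hU1])
    have hne1 : ∀ u ∈ ({u₂, u₃, u₄} : Finset A), u₁ ≠ u ∧ u ∈ U := fun u hu => by
      rw [← hE, mem_erase] at hu
      exact ⟨hu.1.symm, hu.2⟩
    obtain ⟨h2, hu₂⟩ := hne1 u₂ (by simp)
    obtain ⟨h3', hu₃⟩ := hne1 u₃ (by simp)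
    obtain ⟨h4, hu₄⟩ := hne1 u₄ (by simp)
    rw [← add_sum_erase U _ hu₁, hE, sum_insert (by simp [hu23, hu24]), sum_pair hu34,
      sum_singleton] at hsum
    have hx := h.add_sub_notMem (hU hu₁) (hU hu₂) (hV (by simp : v ∈ _))
      (hUV _ hu₁ _ (by simp)) (hUV _ hu₂ _ (by simp))
    refine (h.false_of_three hx h2 h3' hu23
      ⟨hU hu₁, v, hV (by simp), u₂, hU hu₂, by abel⟩
      ⟨hU hu₂, v, hV (by simp), u₁, hU hu₁, by abel⟩
      ⟨hU hu₃, u₄, hU hu₄, u₃, hU hu₃, ?_⟩).elim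
    -- `-u₃ = u₃ + u₃` in exponent three, which gives an expression with a third first term
    calc u₁ + u₂ - v + u₄ = u₁ + (u₂ + (u₃ + u₄)) - v - u₃ := by abel
      _ = -u₃ := by rw [hsum]; abel
      _ = u₃ + u₃ := (eq_neg_of_add_eq_zero_left (htriple u₃)).symm
  · have hUΛ : U = Λ := eq_of_subset_of_card_le hU (by rw [hU1, h.card_eq])
    rw [← hUΛ, hsum, card_eq_zero.1 hV1, sum_empty]

open Finset in
/-- The six points of `Λ` are affinely dependent in the four-dimensional space `A`. -/
theorem sum_eq_zero (h : IsSingerLine Λ) [Module (ZMod 3) A] [Fintype A]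
    (hA : Module.finrank (ZMod 3) A = 4) : ∑ l ∈ Λ, l = 0 := by
  classical
  have : Module.Finite (ZMod 3) A := Module.Finite.of_finite
  have h3 : ∀ x : A, (3 : ℕ) • x = 0 := fun x => by
    rw [← Nat.cast_smul_eq_nsmul (ZMod 3), show ((3 : ℕ) : ZMod 3) = 0 from rfl, zero_smul]
  obtain ⟨f, hf, hf0, l, hl, hfl⟩ :=
    Module.exists_nontrivial_relation_sum_zero_of_finrank_succ_lt_card (R := ZMod 3) (t := Λ)
      (by rw [hA, h.card_eq]; norm_num)
  have hval : ∀ c : ZMod 3, c = (if c = 1 then 1 else 0) - (if c = 2 then 1 else 0) := by decide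
  have hsum : ∑ u ∈ Λ with f u = 1, u = ∑ u ∈ Λ with f u = 2, u := by
    rw [← sub_eq_zero, ← hf, sum_filter, sum_filter, ← sum_sub_distrib]
    refine sum_congr rfl fun u _ => ?_
    conv_rhs => rw [hval (f u), sub_smul, ite_smul, ite_smul, one_smul, zero_smul]
  have hmod : #{u ∈ Λ | f u = 1} ≡ #{u ∈ Λ | f u = 2} [MOD 3] := by
    rw [← ZMod.natCast_eq_natCast_iff, ← sub_eq_zero, ← hf0, ← sum_boole, ← sum_boole,
      ← sum_sub_distrib]
    exact sum_congr rfl fun u _ => (hval (f u)).symm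
  have hdisj : Disjoint {u ∈ Λ | f u = 1} {u ∈ Λ | f u = 2} :=
    disjoint_filter.2 fun u _ h1 h2 => absurd (h1.symm.trans h2) (by decide)
  have hne : 0 < #{u ∈ Λ | f u = 1} + #{u ∈ Λ | f u = 2} := by
    rw [← card_union_of_disjoint hdisj, card_pos]
    refine ⟨l, ?_⟩
    rw [mem_union, mem_filter, mem_filter]
    have : ∀ c : ZMod 3, c ≠ 0 → c = 1 ∨ c = 2 := by decide
    exact (this _ hfl).imp (fun h' => ⟨hl, h'⟩) (fun h' => ⟨hl, h'⟩)
  rcases le_total #{u ∈ Λ | f u = 2} #{u ∈ Λ | f u = 1} with hle | hle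
  · exact h.sum_eq_zero_of_sum_eq_sum h3 (filter_subset _ _) (filter_subset _ _) hdisj hmod hle
      (card_pos.1 (by omega)) hsum
  · exact h.sum_eq_zero_of_sum_eq_sum h3 (filter_subset _ _) (filter_subset _ _) hdisj.symm
      hmod.symm hle (card_pos.1 (by omega)) hsum.symm

end IsSingerLine

namespace GaloisField

theorem exists_isPrimitiveRoot_five : ∃ ζ : GaloisField 3 4, IsPrimitiveRoot ζ 5 := by
  have : Fact (Nat.Prime 5) := ⟨Nat.prime_five⟩
  obtain ⟨u, hu⟩ := exists_prime_orderOf_dvd_card' (G := (GaloisField 3 4)ˣ) 5 (by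
    rw [Nat.card_units, GaloisField.card 3 4 (by norm_num)]; norm_num)
  refine ⟨u, ?_⟩
  rw [← hu, IsPrimitiveRoot.coe_units_iff]
  exact IsPrimitiveRoot.orderOf u

open IntermediateField in
/-- No proper subfield of the field with `81` elements contains an element of order five. -/
theorem natDegree_minpoly_of_isPrimitiveRoot_five {ζ : GaloisField 3 4} (hζ : IsPrimitiveRoot ζ 5) :
    (minpoly (ZMod 3) ζ).natDegree = 4 := by
  have hint : IsIntegral (ZMod 3) ζ := Algebra.IsIntegral.isIntegral ζ
  have hfr : Module.finrank (ZMod 3) (GaloisField 3 4) = 4 := GaloisField.finrank 3 (by norm_num)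
  rw [← adjoin.finrank hint]
  set d := Module.finrank (ZMod 3) (ZMod 3)⟮ζ⟯ with hd
  have hdvd : d ∣ 4 := by
    rw [← hfr]
    exact ⟨_, (Module.finrank_mul_finrank (ZMod 3) (ZMod 3)⟮ζ⟯ (GaloisField 3 4)).symm⟩
  have : Fintype (ZMod 3)⟮ζ⟯ := Fintype.ofFinite _
  have hcard : Fintype.card (ZMod 3)⟮ζ⟯ = 3 ^ d := by
    rw [Module.card_eq_pow_finrank (K := ZMod 3), ZMod.card]
  have hpow : ζ ^ 3 ^ d = ζ := by
    have := congrArg Subtype.val (FiniteField.pow_card (AdjoinSimple.gen (ZMod 3) ζ))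
    rwa [hcard] at this
  have h5 : 5 ∣ 3 ^ d - 1 := by
    refine hζ.dvd_of_pow_eq_one _ (mul_left_cancel₀ (hζ.ne_zero (by norm_num)) ?_)
    rw [mul_one, ← pow_succ', Nat.sub_add_cancel (Nat.one_le_pow _ _ (by norm_num)), hpow]
  have hle : d ≤ 4 := Nat.le_of_dvd (by norm_num) hdvd
  interval_cases d
  · norm_num at hdvd
  · exact absurd h5 (by decide)
  · exact absurd h5 (by decide)
  · norm_num at hdvd
  · rfl

end GaloisField

namespace IsSingerLine

variable {A : Type*} [AddCommGroup A] {Λ : Finset A}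

/-- The five nonzero points of `Λ` span `A` and their sum vanishes. The same holds for the five
fifth roots of unity. -/
theorem exists_equiv (h : IsSingerLine Λ) [Module (ZMod 3) A] [Fintype A]
    (hA : Module.finrank (ZMod 3) A = 4) :
    ∃ f : A ≃+ GaloisField 3 4, ∀ x, x ∈ Λ ↔ f x = 0 ∨ f x ^ 5 = 1 := by
  classical
  have : Module.Finite (ZMod 3) A := Module.Finite.of_finite
  obtain ⟨ζ, hζ⟩ := GaloisField.exists_isPrimitiveRoot_five
  have hli := linearIndependent_pow (K := ZMod 3) ζ
  rw [GaloisField.natDegree_minpoly_of_isPrimitiveRoot_five hζ] at hli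
  let bF := basisOfLinearIndependentOfCardEqFinrank hli (by
    rw [Fintype.card_fin, GaloisField.finrank 3 (by norm_num)])
  have hbF : ∀ i : Fin 4, bF i = ζ ^ (i : ℕ) := fun i => by simp [bF]
  obtain ⟨e⟩ : Nonempty (Fin 5 ≃ Λ.erase 0) := by
    refine ⟨(Fintype.equivFinOfCardEq ?_).symm⟩
    rw [Fintype.card_coe, Finset.card_erase_of_mem h.zero_mem, h.card_eq]
  have hmem : ∀ x, x ∈ Λ ↔ x = 0 ∨ ∃ i, (e i : A) = x := by
    intro x
    constructor
    · intro hx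
      by_cases hx0 : x = 0
      · exact Or.inl hx0
      · exact Or.inr ⟨e.symm ⟨x, Finset.mem_erase.2 ⟨hx0, hx⟩⟩, by simp⟩
    · rintro (rfl | ⟨i, rfl⟩)
      · exact h.zero_mem
      · exact Finset.mem_of_mem_erase (e i).2
  have hsum : ∑ i, (e i : A) = 0 := by
    have h0 := h.sum_eq_zero hA
    rw [← Finset.add_sum_erase Λ _ h.zero_mem, zero_add, ← Finset.sum_coe_sort (Λ.erase 0)] at h0
    exact (e.sum_comp fun x => (x : A)).trans h0
  rw [Fin.sum_univ_castSucc] at hsum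
  have hlast : (e (Fin.last 4) : A) = -∑ i : Fin 4, (e i.castSucc : A) :=
    (neg_eq_of_add_eq_zero_right hsum).symm
  have hspan : ⊤ ≤ Submodule.span (ZMod 3) (Set.range fun i : Fin 4 => (e i.castSucc : A)) := by
    have htop := h.eq_top_of_subset (H := (Submodule.span (ZMod 3)
      (Set.range fun i : Fin 4 => (e i.castSucc : A))).toAddSubgroup) (by
        intro l hl
        rw [Submodule.mem_toAddSubgroup]
        have hmemspan : ∀ i : Fin 4, (e i.castSucc : A) ∈ Submodule.span (ZMod 3)
            (Set.range fun i : Fin 4 => (e i.castSucc : A)) := fun i =>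
          Submodule.subset_span ⟨i, rfl⟩
        rcases (hmem l).1 hl with rfl | ⟨i, rfl⟩
        · exact Submodule.zero_mem _
        · refine Fin.lastCases ?_ hmemspan i
          rw [hlast]
          exact Submodule.neg_mem _ (Submodule.sum_mem _ fun i _ => hmemspan i))
    intro x _
    rw [← Submodule.mem_toAddSubgroup, htop]
    trivial
  let bA := basisOfTopLeSpanOfCardEqFinrank _ hspan (by rw [Fintype.card_fin, hA])
  have hbA : ∀ i : Fin 4, bA i = (e i.castSucc : A) := fun i => by simp [bA]
  let f := bA.equiv bF (Equiv.refl _)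
  have hf' : ∀ i : Fin 4, f (e i.castSucc : A) = ζ ^ (i : ℕ) := by
    intro i
    rw [← hbA, Module.Basis.equiv_apply, Equiv.refl_apply, hbF]
  have hf : ∀ i : Fin 5, f (e i : A) = ζ ^ (i : ℕ) := by
    refine Fin.lastCases ?_ hf'
    have hgeom := hζ.geom_sum_eq_zero (by norm_num)
    rw [Finset.sum_range_succ, Finset.sum_range] at hgeom
    rw [hlast, map_neg, map_sum, Finset.sum_congr rfl fun i _ => hf' i]
    exact neg_eq_of_add_eq_zero_right hgeom
  refine ⟨f.toAddEquiv, fun x => ?_⟩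
  rw [hmem]
  refine or_congr (f.map_eq_zero_iff).symm ⟨?_, ?_⟩
  · rintro ⟨i, rfl⟩
    change f (e i : A) ^ 5 = 1
    rw [hf, ← pow_mul, mul_comm, pow_mul, hζ.pow_eq_one, one_pow]
  · intro hx
    obtain ⟨i, hi, hix⟩ := hζ.eq_pow_of_pow_eq_one hx
    exact ⟨⟨i, hi⟩, f.injective ((hf ⟨i, hi⟩).trans hix)⟩

theorem exists_equiv_of_card (h : IsSingerLine Λ) [Fintype A] (hA : Fintype.card A = 81) :
    ∃ f : A ≃+ GaloisField 3 4, ∀ x, x ∈ Λ ↔ f x = 0 ∨ f x ^ 5 = 1 := by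
  let _ : Module (ZMod 3) A := AddCommGroup.zmodModule (h.three_nsmul_eq_zero hA)
  refine h.exists_equiv ?_
  have h1 := Module.card_eq_pow_finrank (K := ZMod 3) (V := A)
  rw [hA, ZMod.card, show 81 = 3 ^ 4 by norm_num] at h1
  exact (Nat.pow_right_injective (le_refl 2 |>.trans (by norm_num)) h1).symm

end IsSingerLine

/-! ### From the Singer group back to the geometry -/

namespace IsRigidPartialGeometry

open IsProperPartialGeometry

variable {G P L : Type*} [CommGroup G] [MulAction G P] [MulAction G L] {I : P → L → Prop}
  {s α : ℕ}

/-- If there are as many lines as points, the Singer group is sharply transitive on the lines. -/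
theorem bijective_smul_line (h : IsRigidPartialGeometry G I s s α) (ℓ₀ : L) :
    Function.Bijective fun g : G => g • ℓ₀ := by
  have := h.partialGeometry.finite_points
  have := h.partialGeometry.finite_lines
  have : Fintype P := Fintype.ofFinite _
  have : Fintype L := Fintype.ofFinite _
  obtain ⟨p₀⟩ := h.partialGeometry.nonempty_points
  have : Fintype G := Fintype.ofEquiv P (h.pointEquiv p₀).symm
  rw [Fintype.bijective_iff_injective_and_card]
  constructor
  · intro g k (hgk : g • ℓ₀ = k • ℓ₀)
    have h1 : k⁻¹ * g ∈ MulAction.stabilizer G ℓ₀ := by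
      rw [MulAction.mem_stabilizer_iff, mul_smul, hgk, inv_smul_smul]
    rw [h.rigid, Subgroup.mem_bot] at h1
    exact (inv_mul_eq_one.1 h1).symm
  · rw [Fintype.card_congr (h.pointEquiv p₀)]
    exact (Nat.eq_of_mul_eq_mul_right (Nat.succ_pos s) h.partialGeometry.card_lines_mul).symm

variable [Fintype G]

open Classical in
/-- The points of the line `ℓ₀`, seen as elements of the Singer group: `a` stands for the point
`a • p₀`. -/
noncomputable def singerLine (G : Type*) {P L : Type*} [CommGroup G] [MulAction G P] [Fintype G]
    (I : P → L → Prop) (p₀ : P) (ℓ₀ : L) : Finset (Additive G) :=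
  {a | I (a.toMul • p₀) ℓ₀}

theorem mem_singerLine {G P L : Type*} [CommGroup G] [MulAction G P] [Fintype G]
    {I : P → L → Prop} {p₀ : P} {ℓ₀ : L} {a : Additive G} :
    a ∈ singerLine G I p₀ ℓ₀ ↔ I (a.toMul • p₀) ℓ₀ := by
  simp [singerLine]

variable {p₀ : P} {ℓ₀ : L}

theorem smul_incident_smul_iff (h : IsRigidPartialGeometry G I s s α) {a b : Additive G} :
    I (a.toMul • p₀) (b.toMul • ℓ₀) ↔ a - b ∈ singerLine G I p₀ ℓ₀ := by
  rw [mem_singerLine, ← h.singer.smul_incident_iff b.toMul ((a - b).toMul • p₀), ← mul_smul,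
    ← toMul_add, add_sub_cancel]

theorem linesThrough_ne_zero_iff (h : IsRigidPartialGeometry G I s s α) (ℓ₀ : L) {g : Additive G} :
    linesThrough I p₀ (g.toMul • p₀) ≠ 0 ↔
      ∃ c ∈ singerLine G I p₀ ℓ₀, ∃ d ∈ singerLine G I p₀ ℓ₀, g = c - d := by
  have := h.partialGeometry.finite_lines
  rw [linesThrough, Nat.cast_ne_zero, ← Nat.pos_iff_ne_zero, Set.ncard_pos]
  have hinc : ∀ b : Additive G, I p₀ (b.toMul • ℓ₀) ↔ 0 - b ∈ singerLine G I p₀ ℓ₀ := fun b => by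
    rw [← h.smul_incident_smul_iff, toMul_zero, one_smul]
  constructor
  · rintro ⟨m, hm₀, hm⟩
    obtain ⟨b, rfl⟩ := (h.bijective_smul_line ℓ₀).2 m
    exact ⟨g - Additive.ofMul b, h.smul_incident_smul_iff.1 hm, 0 - Additive.ofMul b,
      (hinc (Additive.ofMul b)).1 hm₀, by abel⟩
  · rintro ⟨c, hc, d, hd, rfl⟩
    refine ⟨(-d).toMul • ℓ₀, (hinc _).2 ?_, h.smul_incident_smul_iff.2 ?_⟩
    · rwa [zero_sub, neg_neg]
    · rwa [sub_neg_eq_add, sub_add_cancel]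

theorem eq_of_sub_eq_sub (h : IsRigidPartialGeometry G I s s α) {a b c d : Additive G}
    (ha : a ∈ singerLine G I p₀ ℓ₀) (hb : b ∈ singerLine G I p₀ ℓ₀) (hc : c ∈ singerLine G I p₀ ℓ₀)
    (hd : d ∈ singerLine G I p₀ ℓ₀) (hab : a ≠ b) (heq : a - b = c - d) : a = c := by
  by_contra hac
  have hline : ℓ₀ ≠ (c - a).toMul • ℓ₀ := by
    intro h0
    have h1 := (h.bijective_smul_line ℓ₀).1 (a₁ := 1) (a₂ := (c - a).toMul)
      (by simpa using h0)
    exact hac (sub_eq_zero.1 (Additive.toMul.injective h1).symm).symm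
  have hcd := h.partialGeometry.line_inter_line _ _ hline (c.toMul • p₀) (d.toMul • p₀)
    (mem_singerLine.1 hc) (h.smul_incident_smul_iff.2 (by rwa [sub_sub_cancel]))
    (mem_singerLine.1 hd) (h.smul_incident_smul_iff.2 (by
      rwa [show d - (c - a) = a - (c - d) by abel, ← heq, sub_sub_cancel]))
  rw [Additive.toMul.injective ((h.pointEquiv p₀).injective hcd), sub_self] at heq
  exact hab (sub_eq_zero.1 heq)

theorem card_singerLine (h : IsRigidPartialGeometry G I s s α) :
    (singerLine G I p₀ ℓ₀).card = s + 1 := by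
  rw [← h.partialGeometry.points_on_line ℓ₀, ← Set.ncard_coe_finset]
  refine Set.ncard_congr (fun a _ => a.toMul • p₀) (fun a ha => mem_singerLine.1 ha)
    (fun a b _ _ hab => Additive.toMul.injective ((h.pointEquiv p₀).injective hab)) fun q hq => ?_
  obtain ⟨g, rfl⟩ := (h.pointEquiv p₀).surjective q
  exact ⟨Additive.ofMul g, mem_singerLine.2 hq, rfl⟩

theorem ncard_lines_singerLine (h : IsRigidPartialGeometry G I s s α) {x : Additive G}
    (hx : x ∉ singerLine G I p₀ ℓ₀) :
    Set.ncard {l₁ | l₁ ∈ singerLine G I p₀ ℓ₀ ∧ ∃ l₂ ∈ singerLine G I p₀ ℓ₀,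
      ∃ l₃ ∈ singerLine G I p₀ ℓ₀, x + l₂ = l₁ + l₃} = α := by
  rw [mem_singerLine] at hx
  rw [← h.partialGeometry.antiflag _ _ hx]
  refine Set.ncard_congr (fun l _ => (x - l).toMul • ℓ₀) ?_ ?_ ?_
  · rintro l ⟨hl, l₂, hl₂, l₃, hl₃, heq⟩
    refine ⟨h.smul_incident_smul_iff.2 (by rwa [sub_sub_cancel]), l₃.toMul • p₀,
      h.smul_incident_smul_iff.2 ?_, mem_singerLine.1 hl₃⟩
    rwa [sub_sub_eq_add_sub, add_comm, ← heq, add_sub_cancel_left]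
  · intro a b _ _ hab
    exact sub_right_injective (Additive.toMul.injective ((h.bijective_smul_line ℓ₀).1 hab))
  · rintro m ⟨hxm, y, hym, hy⟩
    obtain ⟨b, rfl⟩ := (h.bijective_smul_line ℓ₀).2 m
    obtain ⟨g, rfl⟩ := (h.pointEquiv p₀).surjective y
    have h1 := (h.smul_incident_smul_iff (b := Additive.ofMul b)).1 hxm
    have h2 := (h.smul_incident_smul_iff (a := Additive.ofMul g) (b := Additive.ofMul b)).1 hym
    refine ⟨x - Additive.ofMul b, ⟨h1, _, h2, Additive.ofMul g, mem_singerLine.2 hy, by abel⟩, ?_⟩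
    rw [sub_sub_cancel]
    rfl

theorem isSingerLine (h : IsRigidPartialGeometry G I 5 5 2) (hI : I p₀ ℓ₀)
    (hG : Fintype.card G = 81) : IsSingerLine (singerLine G I p₀ ℓ₀) where
  card_eq := h.card_singerLine
  zero_mem := mem_singerLine.2 (by simpa using hI)
  sidon a ha b hb c hc d hd := h.eq_of_sub_eq_sub ha hb hc hd
  two_lines x hx := h.ncard_lines_singerLine hx
  double a ha b hb := by
    by_cases hab : a = b
    · exact ⟨a, ha, b, hb, by rw [hab, sub_self, smul_zero]⟩
    · rw [← h.linesThrough_ne_zero_iff]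
      have he := h.isCollinearityFunction p₀
      have h1 := (h.linesThrough_ne_zero_iff ℓ₀).2 ⟨a, ha, b, hb, rfl⟩
      have h2 := (he.zero_or_one _ (sub_ne_zero.2 hab)).resolve_left h1
      have h3 := he.conv.two_nsmul_modEq (by rw [Fintype.card_additive, hG]; decide)
        (by norm_num) (a - b)
      rw [h2] at h3
      intro h4
      rw [h4] at h3
      exact absurd h3 (by decide)

theorem card_eq (h : IsRigidPartialGeometry G I 5 5 2) : Fintype.card G = 81 := by
  obtain ⟨p₀⟩ := h.partialGeometry.nonempty_points
  have h1 := (h.isCollinearityFunction p₀).card_mul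
  rw [Fintype.card_additive] at h1
  push_cast at h1
  omega

theorem geometryIsomorphic (h : IsRigidPartialGeometry G I 5 5 2) :
    GeometryIsomorphic I VanLintSchrijver := by
  have := h.partialGeometry.finite_lines
  obtain ⟨p₀⟩ := h.partialGeometry.nonempty_points
  obtain ⟨ℓ₀, hI⟩ : {ℓ : L | I p₀ ℓ}.Nonempty := by
    apply Set.nonempty_of_ncard_ne_zero
    rw [h.partialGeometry.lines_through_point]
    norm_num
  obtain ⟨f, hf⟩ := (h.isSingerLine hI h.card_eq).exists_equiv_of_card
    (by rw [Fintype.card_additive, h.card_eq])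
  let points := (Additive.toMul (α := G)).trans (h.pointEquiv p₀)
  let lines := (Additive.toMul (α := G)).trans (Equiv.ofBijective _ (h.bijective_smul_line ℓ₀))
  refine ⟨points.symm.trans f.toEquiv, lines.symm.trans f.toEquiv, fun p ℓ => ?_⟩
  obtain ⟨a, rfl⟩ := points.surjective p
  obtain ⟨b, rfl⟩ := lines.surjective ℓ
  change VanLintSchrijver (f (points.symm (points a))) (f (lines.symm (lines b))) ↔
    I (a.toMul • p₀) (b.toMul • ℓ₀)
  rw [Equiv.symm_apply_apply, Equiv.symm_apply_apply]
  rw [h.smul_incident_smul_iff, hf, map_sub, VanLintSchrijver]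

end IsRigidPartialGeometry

/-- A bound on the number of points bounds `α`, since `s ^ 2 < |A|`. -/
theorem IsCollinearityFunction.le_of_card_lt {A : Type*} [AddCommGroup A] [Fintype A] {e : A → ℤ}
    {s t α : ℕ} (h : IsCollinearityFunction e s t α) (hst : s + 1 ∣ t + 1)
    (hA : Fintype.card A < 10 ^ 6) : α ≤ 1000 := by
  have h1 := h.card_mul
  have h2 := h.lt_left
  have h3 := h.pos
  have h4 : s + 1 ≤ t + 1 := Nat.le_of_dvd (Nat.succ_pos t) hst
  by_contra! hα
  zify at hA h2 h3 h4 hα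
  have h5 : (Fintype.card A : ℤ) * α ≤ 10 ^ 6 * α := by gcongr
  -- `|A| α = (s + 1) (s t + α)` with `s > 1000` and `t ≥ α`
  have h6 : ((1000 : ℤ) * 1000) * α ≤ s * (s * t) := by
    have : (α : ℤ) ≤ t := by omega
    calc ((1000 : ℤ) * 1000) * α ≤ (s * s) * t := by gcongr <;> omega
      _ = s * (s * t) := by ring
  nlinarith

theorem mainTheorem3 {P L G : Type*} [CommGroup G] [MulAction G P] [MulAction G L]
    (I : P → L → Prop) (s t α : ℕ) (h : IsRigidPartialGeometry G I s t α) :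
    (α ≤ 1000 →
      (s = 5 ∧ t = 5 ∧ α = 2 ∧ GeometryIsomorphic I VanLintSchrijver) ∨
      (s = 11 ∧ t = 23 ∧ α = 3) ∨
      (s = 39 ∧ t = 39 ∧ α = 15) ∨
      (s = 272 ∧ t = 272 ∧ α = 104) ∨
      (s = 2295 ∧ t = 4591 ∧ α = 615)) ∧
    (Nat.card P < 10 ^ 6 →
      GeometryIsomorphic I VanLintSchrijver ∨
      Nat.card P = 1024 ∨ Nat.card P = 4096 ∨ Nat.card P = 194481) := by
  have := h.partialGeometry.finite_points
  obtain ⟨p₀⟩ := h.partialGeometry.nonempty_points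
  have : Fintype P := Fintype.ofFinite _
  have : Fintype G := Fintype.ofInjective _ (h.pointEquiv p₀).injective
  have he := h.isCollinearityFunction p₀
  have hcard : Nat.card P = Fintype.card (Additive G) := by
    rw [← Nat.card_congr (h.pointEquiv p₀), Fintype.card_additive, Nat.card_eq_fintype_card]
  refine ⟨fun hα => ?_, fun hP => ?_⟩
  · refine (he.parameters h.succ_dvd_succ hα).imp_left ?_
    rintro ⟨rfl, rfl, rfl⟩
    exact ⟨rfl, rfl, rfl, h.geometryIsomorphic⟩
  · rw [hcard] at hP ⊢
    have h1 := he.card_mul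
    rcases he.parameters h.succ_dvd_succ (he.le_of_card_lt h.succ_dvd_succ hP) with
      ⟨rfl, rfl, rfl⟩ | ⟨rfl, rfl, rfl⟩ | ⟨rfl, rfl, rfl⟩ | ⟨rfl, rfl, rfl⟩ | ⟨rfl, rfl, rfl⟩
    · exact Or.inl h.geometryIsomorphic
    all_goals push_cast at h1; omega
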